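/- **Setting.** Let $(C(t))_{t\in\mathbb R}$ be a uniformly bounded cosine function on a complex Banach space $X$: a strongly continuous family of bounded operators with $C(0)=I$, $C(t+s)+C(t-s)=2C(t)C(s)$ for $s,t\in\mathbb R$, and $\sup_t\|C(t)\|<\infty$. Let $Ax=\lim_{t\to0}\frac{2}{t^2}(C(t)x-x)$ be its generator, with $D(A)$ the set of $x$ for which the limit exists. Put $S(t)x=\int_0^tC(s)x\,ds$, $H_n(t)=(-1)^ne^{t^2}\frac{d^n}{dt^n}e^{-t^2}$, $h_n(t)=\frac{1}{2^nn!\sqrt\pi}e^{-t^2}H_n(t)$, $T(z)x=\frac1{\sqrt{\pi z}}\int_0^\infty e^{-t^2/4z}C(t)x\,dt$ for $\Re z>0$, $$C_m(t)x=\sum_{n=0}^m\frac{A^nT(\frac14)x}{2^{2n}(2n)!}H_{2n}(t),\qquad S_m(t)x=\sum_{n=0}^m\frac{A^nT(\frac14)x}{2^{2n+1}(2n+1)!}H_{2n+1}(t),$$ $f_t(s)=\frac{1-\cos(ts)}{\pi s^2}$ and $\mathcal F^C(t)x=2\int_0^\infty f_t(s)C(s)x\,ds$. All these objects are well defined; in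 particular all the integrals that occur converge absolutely, and $T(\frac14)x\in D(A^n)$ for all $x\in X$, $n\ge0$. **Theorem.** (i) There is $c>0$ such that for all integers $n\ge p\ge1$ and all $x\in D(A^p)$, $$\Big\|\int_{-\infty}^\infty h_{2n}(t)C(t)x\,dt\Big\|\le\frac{c\sqrt{(2n-2p)!}}{2^{n+p}(2n)!}\|A^px\|.$$ (ii) There is $c>0$ such that for all integers $n\ge p\ge0$ and all $x\in D(A^p)$, $$\Big\|\int_{-\infty}^\infty h_{2n+1}(t)S(t)x\,dt\Big\|\le\frac{c\sqrt{(2n-2p)!}}{2^{n+p+1}(2n+1)!}\|A^px\|,$$ and, if $n\ge p+1$ and $x\in D(A^{p+1})$, the same bound holds with $\|A^{p+1}x\|$ in place of $\|A^px\|$. (iii) For each $t\in\mathbb R$ there is an integer $m_0\ge1$ such that for every integer $p\ge1$ there is $C_{t,p}>0$ with the following property: for all $m\ge m_0$ with $p\le m+1$, $$\|C(t)x-C_m(t)x\|\le\frac{C_{t,p}}{m^{p-11/12}}\|A^px\|,\qquad \|S(t)x-S_m(t)x\|\le\frac{C_{t,p}}{m^{p-5/12}}\|A^px\|,\qquad x\in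 D(A^p),$$ and, if moreover $p\le m$, $$\|S(t)x-S_m(t)x\|\le\frac{C_{t,p}}{m^{p-5/12}}\|A^{p+1}x\|,\qquad x\in D(A^{p+1}).$$ The estimates are locally uniform in $t$: on a compact set $K\subset\mathbb R$, the number $m_0$ can be chosen depending only on $K$, and the constant depending only on $K$ and $p$, so that they hold for all $t\in K$. (The constants $c$, $m_0$, $C_{t,p}$ may depend on the cosine function.) (iv) For all $x\in X$ and $t\in\mathbb R$, with an unconditionally convergent series, $$\mathcal F^C(t)x=2\int_0^\infty\frac{1-e^{-s^2/4}}{\pi s^2}C(s)x\,ds+2\sum_{n=1}^\infty\Big(\int_0^\infty\frac{(-1)^{n-1}s^{2n-2}e^{-s^2/4}}{2^{2n}(2n)!\,\pi}C(s)x\,ds\Big)H_{2n}(t).$$ -/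

import Mathlib

open Filter Topology MeasureTheory

noncomputable section

namespace CosineHermite

/-- Physicists' Hermite polynomials, by the Rodrigues formula
`H_n(t) = (-1)^n e^{t^2} (d/dt)^n e^{-t^2}`. -/
def hermiteH (n : ℕ) (t : ℝ) : ℝ :=
  (-1) ^ n * Real.exp (t ^ 2) * iteratedDeriv n (fun u : ℝ => Real.exp (-u ^ 2)) t

/-- The functions `h_n(t) = e^{-t^2} H_n(t) / (2^n n! √π)`. -/
def hermiteh (n : ℕ) (t : ℝ) : ℝ :=
  1 / (2 ^ n * (n.factorial : ℝ) * √Real.pi) * Real.exp (-t ^ 2) * hermiteH n t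

/-- The Fejér kernel `f_t(s) = (1 - cos (t s)) / (π s^2)`, for `s ≠ 0`. -/
def fejerKernel (t s : ℝ) : ℝ := (1 - Real.cos (t * s)) / (Real.pi * s ^ 2)

variable {X : Type*} [NormedAddCommGroup X] [NormedSpace ℂ X]

/-- Strongly continuous cosine functions of bounded operators. -/
structure IsCosineFunction (C : ℝ → X →L[ℂ] X) : Prop where
  map_zero : C 0 = ContinuousLinearMap.id ℂ X
  add_add_sub : ∀ t s : ℝ, C (t + s) + C (t - s) = (2 : ℂ) • (C t ∘L C s)
  strong_cont : ∀ x : X, Continuous fun t : ℝ => C t x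

/-- The infinitesimal generator: `A x = lim_{t → 0} (2 / t^2) (C(t) x - x)`, whose domain `D(A)`
consists of the `x` for which this limit exists. -/
def generator (C : ℝ → X →L[ℂ] X) : X →ₗ.[ℂ] X where
  domain :=
    { carrier := {x | ∃ y : X,
        Tendsto (fun t : ℝ => (2 / t ^ 2) • (C t x - x)) (𝓝[≠] 0) (𝓝 y)}
      zero_mem' := ⟨0, by simp⟩
      add_mem' := by
        rintro a b ⟨y, hy⟩ ⟨z, hz⟩
        refine ⟨y + z, (hy.add hz).congr fun t => ?_⟩
        rw [← smul_add, map_add]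
        congr 1
        abel
      smul_mem' := by
        rintro c a ⟨y, hy⟩
        refine ⟨c • y, (hy.const_smul c).congr fun t => ?_⟩
        rw [smul_comm, map_smul, smul_sub] }
  toFun :=
    { toFun := fun x => x.2.choose
      map_add' := by
        intro a b
        refine tendsto_nhds_unique (a + b).2.choose_spec
          ((a.2.choose_spec.add b.2.choose_spec).congr fun t => ?_)
        rw [← smul_add, Submodule.coe_add, map_add]
        congr 1
        abel
      map_smul' := by
        intro c a
        refine tendsto_nhds_unique (c • a).2.choose_spec
          ((a.2.choose_spec.const_smul c).congr fun t => ?_)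
        have h : ((c • a : _) : X) = c • (a : X) := rfl
        rw [smul_comm, h, map_smul, smul_sub] }

/-- Composition of partially defined operators on its natural domain
`{x ∈ D(f) | f x ∈ D(g)}`. -/
def pcomp (g f : X →ₗ.[ℂ] X) : X →ₗ.[ℂ] X where
  domain :=
    { carrier := {x | ∃ h : x ∈ f.domain, f ⟨x, h⟩ ∈ g.domain}
      zero_mem' := ⟨f.domain.zero_mem, by
        have h : f ⟨0, f.domain.zero_mem⟩ = 0 := f.map_zero
        rw [h]
        exact g.domain.zero_mem⟩
      add_mem' := by
        rintro a b ⟨ha, ha'⟩ ⟨hb, hb'⟩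
        refine ⟨f.domain.add_mem ha hb, ?_⟩
        have h : f ⟨a + b, f.domain.add_mem ha hb⟩ = f ⟨a, ha⟩ + f ⟨b, hb⟩ :=
          f.map_add ⟨a, ha⟩ ⟨b, hb⟩
        rw [h]
        exact g.domain.add_mem ha' hb'
      smul_mem' := by
        rintro c a ⟨ha, ha'⟩
        refine ⟨f.domain.smul_mem c ha, ?_⟩
        have h : f ⟨c • a, f.domain.smul_mem c ha⟩ = c • f ⟨a, ha⟩ := f.map_smul c ⟨a, ha⟩
        rw [h]
        exact g.domain.smul_mem c ha' }
  toFun :=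
    { toFun := fun x => g ⟨f ⟨x, x.2.choose⟩, x.2.choose_spec⟩
      map_add' := by
        intro a b
        rw [← g.map_add]
        congr 1
        exact Subtype.ext (f.map_add ⟨a, a.2.choose⟩ ⟨b, b.2.choose⟩)
      map_smul' := by
        intro c a
        rw [RingHom.id_apply, ← g.map_smul]
        congr 1
        exact Subtype.ext (f.map_smul c ⟨a, a.2.choose⟩) }

/-- The powers of an operator on their natural domains: `D(A^0) = X`,
`D(A^{n+1}) = {x ∈ D(A^n) | A^n x ∈ D(A)}`, `A^{n+1} x = A (A^n x)`. -/
def opPow (A : X →ₗ.[ℂ] X) : ℕ → (X →ₗ.[ℂ] X)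
  | 0 => (LinearMap.id : X →ₗ[ℂ] X).toPMap ⊤
  | n + 1 => pcomp A (opPow A n)

open Classical in
/-- The value `A^n y` if `y ∈ D(A^n)` (and `0` otherwise). -/
def powApply (A : X →ₗ.[ℂ] X) (n : ℕ) (y : X) : X :=
  if h : y ∈ (opPow A n).domain then opPow A n ⟨y, h⟩ else 0

/-- The sine function `S(t) x = ∫_0^t C(s) x ds`. -/
def sine (C : ℝ → X →L[ℂ] X) (t : ℝ) (x : X) : X := ∫ s in (0 : ℝ)..t, C s x

/-- The holomorphic semigroup `T(z) x = (π z)^{-1/2} ∫_0^∞ e^{-t^2/(4z)} C(t) x dt`, `Re z > 0`. -/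
def semigroup (C : ℝ → X →L[ℂ] X) (z : ℂ) (x : X) : X :=
  (1 / (Real.pi * z) ^ (1 / 2 : ℂ)) •
    ∫ t in Set.Ioi (0 : ℝ), Complex.exp (-(t : ℂ) ^ 2 / (4 * z)) • C t x

/-- The partial sum `C_m(t) x = ∑_{n=0}^m A^n T(1/4) x H_{2n}(t) / (2^{2n} (2n)!)`. -/
def cosPartial (C : ℝ → X →L[ℂ] X) (m : ℕ) (t : ℝ) (x : X) : X :=
  ∑ n ∈ Finset.range (m + 1), (hermiteH (2 * n) t / (2 ^ (2 * n) * ((2 * n).factorial : ℝ))) •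
    powApply (generator C) n (semigroup C (1 / 4) x)

/-- The partial sum `S_m(t) x = ∑_{n=0}^m A^n T(1/4) x H_{2n+1}(t) / (2^{2n+1} (2n+1)!)`. -/
def sinPartial (C : ℝ → X →L[ℂ] X) (m : ℕ) (t : ℝ) (x : X) : X :=
  ∑ n ∈ Finset.range (m + 1),
    (hermiteH (2 * n + 1) t / (2 ^ (2 * n + 1) * ((2 * n + 1).factorial : ℝ))) •
      powApply (generator C) n (semigroup C (1 / 4) x)

/-- The subordinated Fejér family `F^C(t) x = 2 ∫_0^∞ f_t(s) C(s) x ds`. -/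
def fejerFamily (C : ℝ → X →L[ℂ] X) (t : ℝ) (x : X) : X :=
  (2 : ℝ) • ∫ s in Set.Ioi (0 : ℝ), fejerKernel t s • C s x

end CosineHermite

end

/-! Up to constants, `h_n` is the n-th derivative of `e^{-t^2}`, so everything reduces to the
pairings `gaussCoeff C n x` of these derivatives with `C(t) x`. The functional equation gives
`C(t+h)x + C(t-h)x - 2C(t)x = 2C(t)(C(h)x - x)`. Moving this second difference between the two
factors of the integral and letting `h → 0` shows that an application of `A` to `x` trades for two
derivatives of the Gaussian (`gaussCoeff_generator`), and that `A` sends the pairing of index `n` to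
that of index `n + 2` for every `x ∈ X` (`generator_gaussCoeff`).

Hence `A^n T(1/4) x` is the pairing of index `2n` divided by `√π`, and `C_m(t) x` is a partial sum
of the Hermite series of `C(·) x`. If `x ∈ D(A^p)`, the pairing of index `2n` is the one of index
`2n - 2p` at `A^p x`; the L¹ bound `integral_abs_gaussDeriv_le` then gives (i). One integration by
parts, with `S' = C`, turns the odd coefficients of `S` into the same pairings and gives (ii).

For (iii) the Hermite series has to sum to `C(t) x`. Inserting factors `r^{2n}` and summing with
Mehler's formula (`hasSum_mehler_even`) produces a Gaussian average that concentrates at `t` as `r →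
1`, so the absolutely convergent series has the right value (`hasSum_hermite_series`). The rate is
that of the tail: the energy bound `|H_{2n}(t)| ≤ e^{t^2} (2n)!/n!` and the pairing bound leave
`n^{-p}` times `√(2n)!/(2^n n!) ≤ (2n+1)^{-1/4}`, of which only `n^{-1/12}` is used. The sine series
follows by termwise integration and gains `n^{-1/2}`.

For (iv), the generating function of the `H_{2n}` at `s/2` expands the Fejér kernel, and the
resulting terms have norm integrals `O(n^{-3/2})`, so sum and integral may be exchanged for every
`x`. -/

noncomputable section

namespace CosineHermite

/-! ### Hermite polynomials and derivatives of the Gaussian -/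

section

open Polynomial

/-- The derivatives of the Gaussian `e^{-t^2}`. -/
def gaussDeriv (n : ℕ) (t : ℝ) : ℝ := iteratedDeriv n (fun u : ℝ => Real.exp (-u ^ 2)) t

/-- The physicists' Hermite polynomials, by recursion. -/
def hermitePoly : ℕ → ℝ[X]
  | 0 => 1
  | n + 1 => 2 * X * hermitePoly n - derivative (hermitePoly n)

lemma contDiff_gauss (n : WithTop ℕ∞) : ContDiff ℝ n (fun u : ℝ => Real.exp (-u ^ 2)) := by
  fun_prop

lemma hasDerivAt_gaussDeriv (n : ℕ) (t : ℝ) :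
    HasDerivAt (gaussDeriv n) (gaussDeriv (n + 1) t) t := by
  have h : Differentiable ℝ (gaussDeriv n) :=
    (contDiff_gauss (n + 1)).differentiable_iteratedDeriv n (by norm_cast; exact Nat.lt_succ_self n)
  have := (h t).hasDerivAt
  rwa [show deriv (gaussDeriv n) t = gaussDeriv (n + 1) t from
    (congrFun (iteratedDeriv_succ (n := n) (f := fun u : ℝ => Real.exp (-u ^ 2))) t).symm] at this

lemma continuous_gaussDeriv (n : ℕ) : Continuous (gaussDeriv n) :=
  continuous_iff_continuousAt.2 fun t => (hasDerivAt_gaussDeriv n t).continuousAt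

lemma gaussDeriv_eq (n : ℕ) (t : ℝ) :
    gaussDeriv n t = (-1) ^ n * (hermitePoly n).eval t * Real.exp (-t ^ 2) := by
  induction n generalizing t with
  | zero => simp [gaussDeriv, hermitePoly]
  | succ n ih =>
    refine (hasDerivAt_gaussDeriv n t).unique ?_
    have hg : HasDerivAt (fun u : ℝ => Real.exp (-u ^ 2)) (Real.exp (-t ^ 2) * -(2 * t)) t := by
      simpa using ((hasDerivAt_pow 2 t).neg).exp
    have := ((((hermitePoly n).hasDerivAt t).const_mul ((-1) ^ n)).mul hg)
    rw [show gaussDeriv n = _ from funext ih]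
    convert! this using 1
    simp [hermitePoly, pow_succ]
    ring

lemma gaussDeriv_zero (t : ℝ) : gaussDeriv 0 t = Real.exp (-t ^ 2) := by simp [gaussDeriv]

lemma hermiteH_eq_eval (n : ℕ) (t : ℝ) : hermiteH n t = (hermitePoly n).eval t := by
  have h : hermiteH n t = (-1) ^ n * Real.exp (t ^ 2) * gaussDeriv n t := rfl
  rw [h, gaussDeriv_eq, Real.exp_neg]
  have h1 : ((-1 : ℝ) ^ n) * (-1) ^ n = 1 := by rw [← mul_pow]; simp
  have := Real.exp_pos (t ^ 2)
  field_simp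
  linear_combination (eval t (hermitePoly n)) * h1

lemma gaussDeriv_eq_hermiteH (n : ℕ) (t : ℝ) :
    gaussDeriv n t = (-1) ^ n * hermiteH n t * Real.exp (-t ^ 2) := by
  rw [gaussDeriv_eq, hermiteH_eq_eval]

lemma hermiteh_eq_gaussDeriv (n : ℕ) (t : ℝ) :
    hermiteh n t = (-1) ^ n / (2 ^ n * (n.factorial : ℝ) * √Real.pi) * gaussDeriv n t := by
  have h1 : ((-1 : ℝ) ^ n) * (-1) ^ n = 1 := by rw [← mul_pow]; simp
  rw [hermiteh, gaussDeriv_eq_hermiteH, div_mul_eq_mul_div, div_mul_eq_mul_div,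
    div_mul_eq_mul_div]
  congr 1
  linear_combination -(Real.exp (-t ^ 2) * hermiteH n t) * h1

lemma continuous_hermiteH (n : ℕ) : Continuous (hermiteH n) := by
  rw [show hermiteH n = _ from funext (hermiteH_eq_eval n)]
  exact (hermitePoly n).continuous

lemma derivative_hermitePoly_succ (n : ℕ) :
    derivative (hermitePoly (n + 1)) = 2 * ((n : ℝ[X]) + 1) * hermitePoly n := by
  induction n with
  | zero => simp [hermitePoly, derivative_mul]
  | succ n ih =>
    have h : hermitePoly (n + 2) = 2 * X * hermitePoly (n + 1) - derivative (hermitePoly (n + 1)) :=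
      rfl
    have h' : hermitePoly (n + 1) = 2 * X * hermitePoly n - derivative (hermitePoly n) := rfl
    rw [h, derivative_sub, derivative_mul, ih]
    have h2 : derivative (2 * ((n : ℝ[X]) + 1) * hermitePoly n)
        = 2 * ((n : ℝ[X]) + 1) * derivative (hermitePoly n) := by
      rw [show (2 * ((n : ℝ[X]) + 1)) = C (2 * ((n : ℝ) + 1)) by
        simp only [map_mul, map_add, map_natCast, map_one]; rfl, derivative_C_mul]
    rw [h2]
    simp only [derivative_mul, derivative_X, derivative_ofNat]
    push_cast
    linear_combination (-(2 * ((n : ℝ[X]) + 1))) * h'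

lemma hermiteH_zero (t : ℝ) : hermiteH 0 t = 1 := by simp [hermiteH_eq_eval, hermitePoly]

lemma hermiteH_one (t : ℝ) : hermiteH 1 t = 2 * t := by simp [hermiteH_eq_eval, hermitePoly]

lemma hasDerivAt_hermiteH_succ (n : ℕ) (t : ℝ) :
    HasDerivAt (hermiteH (n + 1)) (2 * (n + 1) * hermiteH n t) t := by
  rw [show hermiteH (n + 1) = _ from funext (hermiteH_eq_eval (n + 1))]
  convert! (hermitePoly (n + 1)).hasDerivAt t using 1
  rw [derivative_hermitePoly_succ, hermiteH_eq_eval]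
  simp

lemma hasDerivAt_hermiteH (n : ℕ) (t : ℝ) :
    HasDerivAt (hermiteH n) (2 * t * hermiteH n t - hermiteH (n + 1) t) t := by
  rw [show hermiteH n = _ from funext (hermiteH_eq_eval n)]
  convert! (hermitePoly n).hasDerivAt t using 1
  simp only [hermiteH_eq_eval, hermitePoly]
  simp

lemma hermiteH_add_two (n : ℕ) (t : ℝ) :
    hermiteH (n + 2) t = 2 * t * hermiteH (n + 1) t - 2 * (n + 1) * hermiteH n t := by
  have := (hasDerivAt_hermiteH (n + 1) t).unique (hasDerivAt_hermiteH_succ n t)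
  linarith

lemma hermiteH_even_zero (k : ℕ) :
    hermiteH (2 * k) 0 = (-1) ^ k * ((2 * k).factorial / k.factorial) := by
  induction k with
  | zero => simp [hermiteH_zero]
  | succ k ih =>
    rw [show 2 * (k + 1) = 2 * k + 2 by ring, hermiteH_add_two, ih, Nat.factorial_succ (2 * k + 1),
      Nat.factorial_succ (2 * k), Nat.factorial_succ k]
    push_cast
    have := Nat.factorial_pos k
    field_simp
    ring

lemma hermiteH_odd_zero (k : ℕ) : hermiteH (2 * k + 1) 0 = 0 := by
  induction k with
  | zero => simp [hermiteH_one]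
  | succ k ih =>
    rw [show 2 * (k + 1) + 1 = 2 * k + 1 + 2 by ring, hermiteH_add_two, ih]
    simp

/-- The energy `H_{n+1}^2 + 2 (n + 1) H_n^2` grows at most like `e^{2 t^2}`. -/
lemma hermiteH_energy_le (n : ℕ) (t : ℝ) :
    hermiteH (n + 1) t ^ 2 + 2 * (n + 1) * hermiteH n t ^ 2 ≤
      Real.exp (2 * t ^ 2) * (hermiteH (n + 1) 0 ^ 2 + 2 * (n + 1) * hermiteH n 0 ^ 2) := by
  -- In the derivative of the energy the mixed terms cancel, leaving `8 (n+1) t H_n^2`; the weight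
  -- `e^{-2t^2}` removes this too. What is left has the sign of `-t`, so `F` is largest at `0`.
  set F : ℝ → ℝ := fun t => (hermiteH (n + 1) t ^ 2 + 2 * (n + 1) * hermiteH n t ^ 2) *
    Real.exp (-(2 * t ^ 2)) with hF
  have hd : ∀ t, HasDerivAt F (-(4 * t * hermiteH (n + 1) t ^ 2 * Real.exp (-(2 * t ^ 2)))) t := by
    intro t
    have h1 := (hasDerivAt_hermiteH_succ n t).pow 2
    have h2 := ((hasDerivAt_hermiteH n t).pow 2).const_mul (2 * ((n : ℝ) + 1))
    have h3 := (((hasDerivAt_pow 2 t).const_mul 2).neg).exp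
    convert! (h1.add h2).mul h3 using 1
    simp
    ring
  have hc : Continuous F := continuous_iff_continuousAt.2 fun t => (hd t).continuousAt
  have key : F t ≤ F 0 := by
    rcases le_total 0 t with ht | ht
    · refine antitoneOn_of_deriv_nonpos (convex_Ici (0 : ℝ)) hc.continuousOn
        (fun x _ => (hd x).differentiableAt.differentiableWithinAt) (fun x hx => ?_)
        (Set.mem_Ici.2 le_rfl) (Set.mem_Ici.2 ht) ht
      rw [(hd x).deriv]
      rw [interior_Ici, Set.mem_Ioi] at hx
      have : 0 ≤ 4 * x * hermiteH (n + 1) x ^ 2 * Real.exp (-(2 * x ^ 2)) := by positivity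
      linarith
    · refine monotoneOn_of_deriv_nonneg (convex_Iic (0 : ℝ)) hc.continuousOn
        (fun x _ => (hd x).differentiableAt.differentiableWithinAt) (fun x hx => ?_)
        (Set.mem_Iic.2 ht) (Set.mem_Iic.2 le_rfl) ht
      rw [(hd x).deriv]
      rw [interior_Iic, Set.mem_Iio] at hx
      have : 0 ≤ 4 * (-x) * hermiteH (n + 1) x ^ 2 * Real.exp (-(2 * x ^ 2)) := by
        have : 0 < -x := by linarith
        positivity
      linarith
  simp only [hF, Real.exp_neg] at key
  have he := Real.exp_pos (2 * t ^ 2)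
  rw [mul_inv_le_iff₀ he] at key
  simpa [mul_comm] using key

/-- In the energy of index `2k` at `0` only `H_{2k}(0)` survives, since odd Hermite polynomials
vanish there. Dropping the square of `H_{2k+1}(t)` leaves this bound. -/
lemma abs_hermiteH_even_le (k : ℕ) (t : ℝ) :
    |hermiteH (2 * k) t| ≤ Real.exp (t ^ 2) * ((2 * k).factorial / k.factorial) := by
  have h := hermiteH_energy_le (2 * k) t
  rw [hermiteH_odd_zero, hermiteH_even_zero, mul_pow, ← pow_mul, mul_comm k 2, pow_mul] at h
  refine abs_le_of_sq_le_sq ?_ (by positivity)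
  have he : Real.exp (2 * t ^ 2) = Real.exp (t ^ 2) ^ 2 := by rw [← Real.exp_nat_mul]; simp
  rw [he] at h
  push_cast at h
  have hk : (0 : ℝ) < 2 * (2 * k + 1) := by positivity
  refine le_of_mul_le_mul_left ?_ hk
  norm_num at h
  nlinarith [sq_nonneg (hermiteH (2 * k + 1) t), h]

lemma abs_hermiteH_odd_le (k : ℕ) (t : ℝ) :
    |hermiteH (2 * k + 1) t| ≤
      Real.exp (t ^ 2) * (√(2 * (2 * k + 1)) * ((2 * k).factorial / k.factorial)) := by
  have h := hermiteH_energy_le (2 * k) t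
  rw [hermiteH_odd_zero, hermiteH_even_zero, mul_pow, ← pow_mul, mul_comm k 2, pow_mul] at h
  refine abs_le_of_sq_le_sq ?_ (by positivity)
  have he : Real.exp (2 * t ^ 2) = Real.exp (t ^ 2) ^ 2 := by rw [← Real.exp_nat_mul]; simp
  rw [he] at h
  push_cast at h
  rw [mul_pow, mul_pow, Real.sq_sqrt (by positivity)]
  norm_num at h
  have : 0 ≤ 2 * (2 * (k : ℝ) + 1) * hermiteH (2 * k) t ^ 2 := by positivity
  nlinarith

/-- Every derivative of the Gaussian is dominated by a wider Gaussian. -/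
lemma exists_abs_gaussDeriv_le (n : ℕ) :
    ∃ K : ℝ, 0 ≤ K ∧ ∀ t, |gaussDeriv n t| ≤ K * Real.exp (-(t ^ 2 / 2)) := by
  have hpow : ∀ k : ℕ, ∀ t : ℝ, |t ^ k * Real.exp (-(t ^ 2 / 2))| ≤ 1 + (2 ^ k * k.factorial : ℝ) := by
    intro k t
    -- Passing to an even power allows the comparison `x^k / k! ≤ e^x` at `x = t^2/2`.
    have h1 : |t| ^ k ≤ 1 + (t ^ 2) ^ k := by
      rw [← pow_mul, mul_comm 2 k, pow_mul, ← sq_abs, abs_pow]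
      nlinarith [sq_nonneg (|t| ^ k - 1), sq_nonneg (|t| ^ k)]
    have h2 := Real.pow_div_factorial_le_exp (t ^ 2 / 2) (by positivity) k
    have h3 : (t ^ 2) ^ k ≤ 2 ^ k * k.factorial * Real.exp (t ^ 2 / 2) := by
      rw [div_pow, div_div, div_le_iff₀ (by positivity)] at h2
      linarith
    rw [abs_mul, abs_pow, Real.abs_exp, Real.exp_neg, ← div_eq_mul_inv, div_le_iff₀ (by positivity)]
    have : 1 ≤ Real.exp (t ^ 2 / 2) := Real.one_le_exp (by positivity)
    nlinarith
  have hpoly : ∀ p : ℝ[X], ∃ K : ℝ, 0 ≤ K ∧ ∀ t : ℝ, |p.eval t * Real.exp (-(t ^ 2 / 2))| ≤ K := by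
    intro p
    refine ⟨∑ i ∈ Finset.range (p.natDegree + 1), |p.coeff i| * (1 + (2 ^ i * i.factorial : ℝ)),
      Finset.sum_nonneg fun i _ => by positivity, fun t => ?_⟩
    rw [eval_eq_sum_range, Finset.sum_mul]
    refine (Finset.abs_sum_le_sum_abs _ _).trans (Finset.sum_le_sum fun i _ => ?_)
    rw [mul_assoc, abs_mul]
    exact mul_le_mul_of_nonneg_left (hpow i t) (abs_nonneg _)
  obtain ⟨K, hK, h⟩ := hpoly (hermitePoly n)
  refine ⟨K, hK, fun t => ?_⟩
  have := h t
  -- One half of the exponent absorbs the polynomial, the other half remains as the dominating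
  -- Gaussian.
  rw [gaussDeriv_eq, show -t ^ 2 = -(t ^ 2 / 2) + -(t ^ 2 / 2) by ring, Real.exp_add, ← mul_assoc,
    abs_mul _ (Real.exp _), Real.abs_exp]
  refine mul_le_mul_of_nonneg_right ?_ (Real.exp_pos _).le
  rw [mul_assoc, abs_mul, abs_pow, abs_neg, abs_one, one_pow, one_mul]
  exact this

lemma integrable_exp_neg_sq_div {b : ℝ} (hb : 0 < b) :
    Integrable fun t : ℝ => Real.exp (-(t ^ 2 / b)) := by
  refine (integrable_exp_neg_mul_sq (b := 1 / b) (by positivity)).congr (.of_forall fun t => ?_)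
  simp only
  congr 1
  ring

lemma integrable_gaussDeriv (n : ℕ) : Integrable (gaussDeriv n) := by
  obtain ⟨K, hK, h⟩ := exists_abs_gaussDeriv_le n
  exact ((integrable_exp_neg_sq_div two_pos).const_mul K).mono'
    (continuous_gaussDeriv n).aestronglyMeasurable (.of_forall h)

lemma integrable_eval_mul_gaussDeriv (p : ℝ[X]) (n : ℕ) :
    Integrable fun t => p.eval t * gaussDeriv n t := by
  suffices H : ∀ q : ℝ[X], Integrable fun t => q.eval t * Real.exp (-t ^ 2) by
    refine (H (p * C ((-1) ^ n) * hermitePoly n)).congr (.of_forall fun t => ?_)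
    simp [gaussDeriv_eq]
    ring
  intro q
  have : (fun t => q.eval t * Real.exp (-t ^ 2)) = fun t =>
      ∑ i ∈ Finset.range (q.natDegree + 1), q.coeff i * (t ^ (i : ℝ) * Real.exp (-1 * t ^ 2)) := by
    ext t
    simp [eval_eq_sum_range, Finset.sum_mul, mul_assoc]
  rw [this]
  refine integrable_finsetSum _ fun i _ => Integrable.const_mul ?_ _
  exact integrable_rpow_mul_exp_neg_mul_sq one_pos
    (lt_of_lt_of_le (by norm_num : (-1 : ℝ) < 0) (Nat.cast_nonneg i))

lemma integral_exp_neg_sq : ∫ t : ℝ, Real.exp (-t ^ 2) = √Real.pi := by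
  simpa using integral_gaussian 1

/-- `H_{n+1} e^{-t^2}` is up to sign the derivative of `gaussDeriv n`; integrating by parts and
using `H_{n+1}' = 2(n+1) H_n` lowers the index by one. -/
lemma integral_hermiteH_sq (n : ℕ) :
    ∫ t : ℝ, hermiteH n t ^ 2 * Real.exp (-t ^ 2) = 2 ^ n * n.factorial * √Real.pi := by
  induction n with
  | zero => simpa [hermiteH_zero] using integral_exp_neg_sq
  | succ n ih =>
    have h := integral_mul_deriv_eq_deriv_mul_of_integrable (A := ℝ)
      (u := hermiteH (n + 1)) (v := gaussDeriv n)
      (fun t _ => hasDerivAt_hermiteH_succ n t) (fun t _ => hasDerivAt_gaussDeriv n t)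
      (by simpa only [Pi.mul_def, hermiteH_eq_eval] using
        integrable_eval_mul_gaussDeriv (hermitePoly (n + 1)) (n + 1))
      (by
        have := (integrable_eval_mul_gaussDeriv (hermitePoly n) n).const_mul (2 * ((n : ℝ) + 1))
        simpa only [Pi.mul_def, hermiteH_eq_eval, mul_assoc] using this)
      (by simpa only [Pi.mul_def, hermiteH_eq_eval] using
        integrable_eval_mul_gaussDeriv (hermitePoly (n + 1)) n)
    have h1 : ((-1 : ℝ) ^ n) * (-1) ^ n = 1 := by rw [← mul_pow]; simp
    calc ∫ t : ℝ, hermiteH (n + 1) t ^ 2 * Real.exp (-t ^ 2)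
        = ∫ t : ℝ, (-1) ^ (n + 1) * (hermiteH (n + 1) t * gaussDeriv (n + 1) t) := by
          refine integral_congr_ae (.of_forall fun t => ?_)
          simp only [gaussDeriv_eq_hermiteH, pow_succ (-1 : ℝ) n]
          linear_combination -(hermiteH (n + 1) t * hermiteH (n + 1) t * Real.exp (-t ^ 2)) * h1
      _ = (-1) ^ n * ∫ t : ℝ, 2 * (n + 1) * hermiteH n t * gaussDeriv n t := by
          rw [integral_const_mul, h, pow_succ]
          ring
      _ = (2 * (n + 1)) * ∫ t : ℝ, hermiteH n t ^ 2 * Real.exp (-t ^ 2) := by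
          rw [← integral_const_mul, ← integral_const_mul]
          refine integral_congr_ae (.of_forall fun t => ?_)
          simp only [gaussDeriv_eq_hermiteH]
          linear_combination (2 * (n + 1) * hermiteH n t * hermiteH n t * Real.exp (-t ^ 2)) * h1
      _ = _ := by
          rw [ih, Nat.factorial_succ]
          push_cast
          ring

/-- Cauchy–Schwarz for the weight `e^{-t^2}`, in the form `|H| ≤ H^2/(2N) + N/2`. With `N = √(2^n
n!)` both halves have the same integral. -/
lemma integral_abs_gaussDeriv_le (n : ℕ) :
    ∫ t : ℝ, |gaussDeriv n t| ≤ √Real.pi * √(2 ^ n * n.factorial) := by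
  set N : ℝ := √(2 ^ n * n.factorial) with hN
  have hNpos : 0 < N := Real.sqrt_pos.2 (by positivity)
  have hN2 : N ^ 2 = 2 ^ n * n.factorial := Real.sq_sqrt (by positivity)
  have hi : Integrable fun t : ℝ => hermiteH n t ^ 2 * Real.exp (-t ^ 2) := by
    have := integrable_eval_mul_gaussDeriv (hermitePoly n ^ 2) 0
    simpa [gaussDeriv_zero, hermiteH_eq_eval] using this
  have hi0 : Integrable fun t : ℝ => Real.exp (-t ^ 2) := by
    simpa using integrable_exp_neg_mul_sq one_pos
  have hle : ∀ t, |gaussDeriv n t| ≤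
      (1 / (2 * N)) * (hermiteH n t ^ 2 * Real.exp (-t ^ 2)) + N / 2 * Real.exp (-t ^ 2) := by
    intro t
    rw [gaussDeriv_eq_hermiteH, abs_mul, abs_mul, abs_pow, abs_neg, abs_one, one_pow, one_mul,
      Real.abs_exp, ← mul_assoc, ← add_mul]
    refine mul_le_mul_of_nonneg_right ?_ (Real.exp_pos _).le
    have : 0 ≤ (|hermiteH n t| - N) ^ 2 := sq_nonneg _
    rw [sub_sq, sq_abs] at this
    rw [div_mul_eq_mul_div, div_add_div _ _ (by positivity) (by norm_num),
      le_div_iff₀ (by positivity)]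
    nlinarith
  calc ∫ t : ℝ, |gaussDeriv n t|
      ≤ ∫ t : ℝ, ((1 / (2 * N)) * (hermiteH n t ^ 2 * Real.exp (-t ^ 2)) +
          N / 2 * Real.exp (-t ^ 2)) :=
        integral_mono (integrable_gaussDeriv n).abs ((hi.const_mul _).add (hi0.const_mul _)) hle
    _ = √Real.pi * N := by
        rw [integral_add (hi.const_mul _) (hi0.const_mul _), integral_const_mul,
          integral_const_mul, integral_hermiteH_sq, integral_exp_neg_sq, ← hN2]
        field_simp
        ring

end

/-! ### Gaussian moments, generating function and Fourier representation -/

section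

open Polynomial

/-- The inductive step is `(2n+1)(2n+3) ≤ (2n+2)^2`. This decay of the central binomial ratio
supplies the fractional exponents below. -/
lemma factorial_ratio_le (n : ℕ) :
    ((2 * n).factorial : ℝ) / (4 ^ n * (n.factorial : ℝ) ^ 2) ≤ 1 / √(2 * n + 1) := by
  induction n with
  | zero => simp
  | succ n ih =>
    have h1 : ((2 * (n + 1)).factorial : ℝ) / (4 ^ (n + 1) * ((n + 1).factorial : ℝ) ^ 2) =
        ((2 * n + 1) / (2 * n + 2)) * (((2 * n).factorial : ℝ) / (4 ^ n * (n.factorial : ℝ) ^ 2)) := by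
      rw [show 2 * (n + 1) = 2 * n + 1 + 1 by ring, Nat.factorial_succ (2 * n + 1),
        Nat.factorial_succ (2 * n), Nat.factorial_succ n]
      push_cast
      have := Nat.factorial_pos n
      field_simp
      ring
    rw [h1]
    refine (mul_le_mul_of_nonneg_left ih (by positivity)).trans ?_
    push_cast
    have ha : (0 : ℝ) < 2 * n + 1 := by positivity
    have hb : (0 : ℝ) < 2 * (n + 1) + 1 := by positivity
    rw [mul_one_div, div_div, div_le_div_iff₀ (by positivity) (by positivity), one_mul]
    refine le_of_sq_le_sq ?_ (by positivity)
    rw [mul_pow, mul_pow, Real.sq_sqrt ha.le, Real.sq_sqrt hb.le]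
    nlinarith

lemma Gamma_nat_add_half_eq (n : ℕ) :
    Real.Gamma (n + 1 / 2) = √Real.pi * ((2 * n).factorial / (4 ^ n * n.factorial)) := by
  induction n with
  | zero => simp [-one_div, Real.Gamma_one_half_eq]
  | succ n ih =>
    push_cast
    rw [show (n : ℝ) + 1 + 1 / 2 = (n + 1 / 2) + 1 by ring, Real.Gamma_add_one (by positivity), ih,
      show 2 * (n + 1) = 2 * n + 1 + 1 by ring, Nat.factorial_succ (2 * n + 1),
      Nat.factorial_succ (2 * n), Nat.factorial_succ n]
    push_cast
    have := Nat.factorial_pos n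
    field_simp
    ring

lemma integrableOn_even_moment (n : ℕ) {b : ℝ} (hb : 0 < b) :
    IntegrableOn (fun x : ℝ => x ^ (2 * n) * Real.exp (-b * x ^ 2)) (Set.Ioi 0) := by
  have := integrableOn_rpow_mul_exp_neg_mul_sq hb
    (lt_of_lt_of_le (by norm_num : (-1 : ℝ) < 0) (Nat.cast_nonneg (2 * n)))
  simpa only [Real.rpow_natCast] using this

lemma integral_Ioi_even_moment (n : ℕ) {b : ℝ} (hb : 0 < b) :
    ∫ x in Set.Ioi (0 : ℝ), x ^ (2 * n) * Real.exp (-b * x ^ 2) =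
      √(Real.pi / b) / 2 * ((2 * n).factorial / (4 ^ n * n.factorial * b ^ n)) := by
  have h := integral_rpow_mul_exp_neg_mul_rpow (p := 2) (q := (2 * n : ℕ)) two_pos
    (lt_of_lt_of_le (by norm_num : (-1 : ℝ) < 0) (Nat.cast_nonneg (2 * n))) hb
  have e1 : (((2 * n : ℕ) : ℝ) + 1) / 2 = n + 1 / 2 := by push_cast; ring
  have e2 : -(((2 * n : ℕ) : ℝ) + 1) / 2 = -((n : ℝ) + 1 / 2) := by push_cast; ring
  rw [e1, e2, Gamma_nat_add_half_eq, Real.rpow_neg hb.le, Real.rpow_add hb, Real.rpow_natCast,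
    ← Real.sqrt_eq_rpow] at h
  simp only [Real.rpow_natCast, Real.rpow_two] at h
  rw [h, Real.sqrt_div Real.pi_pos.le]
  have := Real.sqrt_pos.2 hb
  field_simp

lemma integrable_even_moment (n : ℕ) {b : ℝ} (hb : 0 < b) :
    Integrable (fun x : ℝ => x ^ (2 * n) * Real.exp (-b * x ^ 2)) := by
  have := integrable_rpow_mul_exp_neg_mul_sq hb
    (lt_of_lt_of_le (by norm_num : (-1 : ℝ) < 0) (Nat.cast_nonneg (2 * n)))
  simpa only [Real.rpow_natCast] using this

lemma integral_even_moment (n : ℕ) {b : ℝ} (hb : 0 < b) :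
    ∫ x : ℝ, x ^ (2 * n) * Real.exp (-b * x ^ 2) =
      √(Real.pi / b) * ((2 * n).factorial / (4 ^ n * n.factorial * b ^ n)) := by
  have h := integral_comp_abs (f := fun x : ℝ => x ^ (2 * n) * Real.exp (-b * x ^ 2))
  simp only [sq_abs, pow_mul] at h
  simp only [← pow_mul] at h
  rw [h, integral_Ioi_even_moment n hb]
  ring

lemma iteratedDeriv_cexp_neg_sq (n : ℕ) (z : ℂ) :
    iteratedDeriv n (fun u : ℂ => Complex.exp (-u ^ 2)) z =
      (-1) ^ n * aeval z (hermitePoly n) * Complex.exp (-z ^ 2) := by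
  induction n generalizing z with
  | zero => simp [hermitePoly]
  | succ n ih =>
    rw [iteratedDeriv_succ, show iteratedDeriv n (fun u : ℂ => Complex.exp (-u ^ 2)) = _ from
      funext ih]
    have hg : HasDerivAt (fun u : ℂ => Complex.exp (-u ^ 2)) (Complex.exp (-z ^ 2) * -(2 * z)) z := by
      simpa using ((hasDerivAt_pow 2 z).neg).cexp
    have := ((((hermitePoly n).hasDerivAt_aeval z).const_mul ((-1 : ℂ) ^ n)).mul hg)
    refine (HasDerivAt.deriv this).trans ?_
    simp [hermitePoly, pow_succ, map_ofNat]
    ring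

/-- The even part of the Hermite generating function on the imaginary axis. -/
lemma hasSum_hermiteH_even (t v : ℝ) :
    HasSum (fun n : ℕ => (-1) ^ n * hermiteH (2 * n) t * v ^ (2 * n) / (2 * n).factorial)
      (Real.cos (2 * t * v) * Real.exp (v ^ 2)) := by
  -- Taylor expansion of `e^{-u^2}` about `t`, evaluated at `t - iv` and multiplied by `e^{t^2}`:
  -- the terms are `H_n(t) (iv)^n / n!`, and the real part keeps the even ones.
  have h := Complex.hasSum_taylorSeries_of_entire
    (f := fun u : ℂ => Complex.exp (-u ^ 2)) (by fun_prop) (t : ℂ) ((t : ℂ) - v * Complex.I)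
  have h1 := Complex.hasSum_re (h.mul_left (Complex.exp ((t : ℂ) ^ 2)))
  have e : Complex.exp ((t : ℂ) ^ 2) * Complex.exp (-((t : ℂ) - v * Complex.I) ^ 2) =
      Complex.exp (((v ^ 2 : ℝ) : ℂ) + ((2 * t * v : ℝ) : ℂ) * Complex.I) := by
    rw [← Complex.exp_add]
    congr 1
    push_cast
    linear_combination (-(v : ℂ) ^ 2) * Complex.I_sq
  rw [e] at h1
  have hterm : ∀ n : ℕ, (Complex.exp ((t : ℂ) ^ 2) * ((n.factorial : ℂ)⁻¹ •
      ((t : ℂ) - v * Complex.I - t) ^ n •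
        iteratedDeriv n (fun u : ℂ => Complex.exp (-u ^ 2)) t)) =
      ((hermiteH n t * v ^ n / n.factorial : ℝ) : ℂ) * Complex.I ^ n := by
    intro n
    have e2 : aeval (t : ℂ) (hermitePoly n) = ((hermiteH n t : ℝ) : ℂ) := by
      rw [hermiteH_eq_eval]
      exact aeval_algebraMap_apply_eq_algebraMap_eval t _
    rw [iteratedDeriv_cexp_neg_sq, e2, Complex.exp_neg, sub_sub_cancel_left, neg_pow, mul_pow]
    have h0 := Complex.exp_ne_zero ((t : ℂ) ^ 2)
    have h2 : ((-1 : ℂ) ^ n) * (-1) ^ n = 1 := by rw [← mul_pow]; simp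
    have h3 : (n.factorial : ℂ) ≠ 0 := by exact_mod_cast n.factorial_ne_zero
    simp only [smul_eq_mul]
    push_cast
    field_simp
    linear_combination (v : ℂ) ^ n * hermiteH n t * h2
  simp only [hterm, Complex.re_ofReal_mul] at h1
  have e3 : (Complex.exp (((v ^ 2 : ℝ) : ℂ) + ((2 * t * v : ℝ) : ℂ) * Complex.I)).re =
      Real.cos (2 * t * v) * Real.exp (v ^ 2) := by
    rw [Complex.exp_re]
    simp [-Complex.ofReal_mul, -Complex.ofReal_pow]
    ring
  rw [e3] at h1
  have hinj : Function.Injective (fun n : ℕ => 2 * n) := fun a b h => by simpa using h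
  rw [← hinj.hasSum_iff] at h1
  · convert! h1 using 1
    ext n
    simp only [Function.comp]
    rw [pow_mul Complex.I, Complex.I_sq]
    rw [show ((-1 : ℂ) ^ n) = (((-1 : ℝ) ^ n : ℝ) : ℂ) by push_cast; rfl, Complex.ofReal_re]
    ring
  · intro n hn
    obtain ⟨k, hk | hk⟩ := n.even_or_odd'
    · exact absurd ⟨k, hk.symm⟩ hn
    · rw [hk, pow_succ Complex.I, pow_mul Complex.I, Complex.I_sq,
        show ((-1 : ℂ) ^ k) = (((-1 : ℝ) ^ k : ℝ) : ℂ) by push_cast; rfl, Complex.re_ofReal_mul]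
      simp

open FourierTransform in
-- `e^{-s^2}` is `√π` times the Fourier transform of `e^{-π^2 x^2}`, and each derivative brings down
-- `-2πix`. Thus `n` enters as a power of `x`, and sums over `n` reduce to the generating function.
lemma gaussDeriv_eq_fourier (n : ℕ) (s : ℝ) :
    (gaussDeriv n s : ℂ) = (√Real.pi : ℂ) * ∫ x : ℝ, Complex.exp (↑(-2 * Real.pi * x * s) * Complex.I) *
      ((-2 * Real.pi * Complex.I * x) ^ n * Complex.exp (-Real.pi * Real.pi * (x : ℂ) ^ 2)) := by
  have h0 : ∀ n : ℕ, iteratedDeriv n (fun u : ℝ => ((Real.exp (-u ^ 2) : ℝ) : ℂ)) =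
      fun u => (gaussDeriv n u : ℂ) := by
    intro n
    induction n with
    | zero => ext u; simp [gaussDeriv_zero]
    | succ n ih =>
      ext u
      rw [iteratedDeriv_succ, ih]
      exact (hasDerivAt_gaussDeriv n u).ofReal_comp.deriv
  have h1 : (fun u : ℝ => ((Real.exp (-u ^ 2) : ℝ) : ℂ)) =
      fun u => (√Real.pi : ℂ) * (𝓕 fun x : ℝ => Complex.exp (-Real.pi * Real.pi * (x : ℂ) ^ 2)) u := by
    have hre : 0 < (Real.pi : ℂ).re := by simpa using Real.pi_pos
    have hpi : (Real.pi : ℂ) ≠ 0 := by exact_mod_cast Real.pi_ne_zero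
    have hs : (Real.pi : ℂ) ^ (1 / 2 : ℂ) = ((√Real.pi : ℝ) : ℂ) := by
      rw [Real.sqrt_eq_rpow, Complex.ofReal_cpow Real.pi_pos.le]
      norm_num
    have hs0 : ((√Real.pi : ℝ) : ℂ) ≠ 0 := by
      exact_mod_cast (Real.sqrt_pos.2 Real.pi_pos).ne'
    rw [fourier_gaussian_pi hre]
    ext u
    rw [hs, neg_div, div_self hpi]
    field_simp
    push_cast
    ring_nf
  have hint : ∀ m : ℕ, Integrable
      (fun x : ℝ => x ^ m • Complex.exp (-Real.pi * Real.pi * (x : ℂ) ^ 2)) := by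
    intro m
    have := (integrable_rpow_mul_exp_neg_mul_sq (b := Real.pi * Real.pi) (by positivity)
      (lt_of_lt_of_le (by norm_num : (-1 : ℝ) < 0) (Nat.cast_nonneg m))).ofReal (𝕜 := ℂ)
    refine this.congr (.of_forall fun x => ?_)
    simp [Complex.real_smul]
  have h2 := congrFun (Real.iteratedDeriv_fourier (N := ⊤) (n := n) (fun m _ => hint m) le_top) s
  have hsm : ContDiff ℝ (n : ℕ) (𝓕 fun x : ℝ => Complex.exp (-Real.pi * Real.pi * (x : ℂ) ^ 2)) := by
    have h3 : (𝓕 fun x : ℝ => Complex.exp (-Real.pi * Real.pi * (x : ℂ) ^ 2)) =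
        fun u : ℝ => (√Real.pi : ℂ)⁻¹ * ((Real.exp (-u ^ 2) : ℝ) : ℂ) := by
      ext u
      have := congrFun h1 u
      rw [this, ← mul_assoc, inv_mul_cancel₀, one_mul]
      exact_mod_cast (Real.sqrt_pos.2 Real.pi_pos).ne'
    rw [h3]
    exact contDiff_const.mul (Complex.ofRealCLM.contDiff.comp (contDiff_gauss _))
  rw [← congrFun (h0 n) s, h1, iteratedDeriv_const_mul_field, h2,
    Real.fourier_real_eq_integral_exp_smul]
  simp only [smul_eq_mul]

end

/-! ### Mehler's formula -/

section

/-- The heat-type kernel in Mehler's formula. -/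
def mehlerGauss (r u : ℝ) : ℝ :=
  (√(Real.pi * (1 - r ^ 2)))⁻¹ * Real.exp (-(u ^ 2 / (1 - r ^ 2)))

open FourierTransform in
lemma mehlerGauss_eq_integral {r : ℝ} (hr : 0 < 1 - r ^ 2) (u : ℝ) :
    (mehlerGauss r u : ℂ) = ∫ x : ℝ, Complex.exp (↑(-2 * Real.pi * x * u) * Complex.I) *
      ((Real.exp (-(Real.pi ^ 2 * (1 - r ^ 2)) * x ^ 2) : ℝ) : ℂ) := by
  have hb : 0 < Real.pi * (1 - r ^ 2) := mul_pos Real.pi_pos hr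
  have hre : 0 < ((Real.pi * (1 - r ^ 2) : ℝ) : ℂ).re := by rwa [Complex.ofReal_re]
  have h := congrFun (fourier_gaussian_pi hre) u
  rw [Real.fourier_real_eq_integral_exp_smul] at h
  simp only [smul_eq_mul] at h
  have e : ∀ x : ℝ, Complex.exp (-Real.pi * ((Real.pi * (1 - r ^ 2) : ℝ) : ℂ) * (x : ℂ) ^ 2) =
      ((Real.exp (-(Real.pi ^ 2 * (1 - r ^ 2)) * x ^ 2) : ℝ) : ℂ) := by
    intro x
    push_cast
    congr 1
    ring
  simp only [e] at h
  rw [h, mehlerGauss]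
  have hs : ((Real.pi * (1 - r ^ 2) : ℝ) : ℂ) ^ (1 / 2 : ℂ) =
      ((√(Real.pi * (1 - r ^ 2)) : ℝ) : ℂ) := by
    rw [Real.sqrt_eq_rpow, Complex.ofReal_cpow hb.le]
    norm_num
  rw [hs, Complex.ofReal_mul, Complex.ofReal_inv, one_div]
  congr 1
  rw [Complex.ofReal_exp]
  congr 1
  have hpi : (Real.pi : ℂ) ≠ 0 := by exact_mod_cast Real.pi_ne_zero
  have hr' : (1 - (r : ℂ) ^ 2) ≠ 0 := by exact_mod_cast hr.ne'
  push_cast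
  field_simp

lemma norm_cexp_ofReal_mul_I_mul (y z : ℝ) :
    ‖Complex.exp ((y : ℂ) * Complex.I) * (z : ℂ)‖ = |z| := by
  rw [norm_mul, Complex.norm_exp_ofReal_mul_I, one_mul, Complex.norm_real, Real.norm_eq_abs]

lemma factorial_ratio_le_one (n : ℕ) :
    ((2 * n).factorial : ℝ) / (4 ^ n * (n.factorial : ℝ) ^ 2) ≤ 1 := by
  refine (factorial_ratio_le n).trans ?_
  rw [div_le_one (Real.sqrt_pos.2 (by positivity))]
  exact Real.one_le_sqrt.2 (by linarith [(Nat.cast_nonneg n : (0 : ℝ) ≤ n)])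

/-- The even part of Mehler's formula. -/
lemma hasSum_mehler_even {r : ℝ} (hr0 : 0 ≤ r) (hr1 : r < 1) (s t : ℝ) :
    HasSum (fun n : ℕ => r ^ (2 * n) * hermiteh (2 * n) s * hermiteH (2 * n) t)
      (1 / 2 * (mehlerGauss r (s - r * t) + mehlerGauss r (s + r * t))) := by
  have hr : 0 < 1 - r ^ 2 := by nlinarith
  set a : ℕ → ℝ → ℝ := fun n x => (-1) ^ n * hermiteH (2 * n) t * (Real.pi * r * x) ^ (2 * n) /
    (2 * n).factorial * Real.exp (-(Real.pi ^ 2) * x ^ 2) with ha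
  set F : ℕ → ℝ → ℂ := fun n x =>
    Complex.exp (↑(-2 * Real.pi * x * s) * Complex.I) * (a n x : ℂ) with hF
  have ha' : ∀ n x, a n x = ((-1) ^ n * hermiteH (2 * n) t * (Real.pi * r) ^ (2 * n) /
      (2 * n).factorial) * (x ^ (2 * n) * Real.exp (-(Real.pi ^ 2) * x ^ 2)) := by
    intro n x
    simp only [ha, mul_pow]
    ring
  have hpi2 : 0 < Real.pi ^ 2 := by positivity
  have haint : ∀ n, Integrable (a n) := fun n => by
    rw [show a n = _ from funext (ha' n)]
    exact (integrable_even_moment n hpi2).const_mul _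
  have hFint : ∀ n, Integrable (F n) := fun n => by
    refine (haint n).norm.mono' ?_ (.of_forall fun x => ?_)
    · refine AEStronglyMeasurable.mul ?_ ?_
      · exact Continuous.aestronglyMeasurable (by fun_prop)
      · exact (haint n).ofReal.aestronglyMeasurable
    · rw [hF, norm_cexp_ofReal_mul_I_mul, Real.norm_eq_abs]
  -- The even moment of `e^{-π^2 x^2}` against the energy bound for `H_{2n}(t)` leaves the central
  -- binomial ratio, at most `1`, so the terms are geometric in `r^2`.
  have hnorm : ∀ n, ∫ x, ‖F n x‖ ≤ Real.exp (t ^ 2) * (r ^ 2) ^ n := by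
    intro n
    have e : ∀ x, ‖F n x‖ = (|hermiteH (2 * n) t| * (Real.pi * r) ^ (2 * n) /
      (2 * n).factorial) * (x ^ (2 * n) * Real.exp (-(Real.pi ^ 2) * x ^ 2)) := by
      intro x
      rw [hF, norm_cexp_ofReal_mul_I_mul, ha', abs_mul, abs_div, abs_mul, abs_mul]
      have h1 : 0 ≤ x ^ (2 * n) * Real.exp (-(Real.pi ^ 2) * x ^ 2) := by
        rw [pow_mul]; positivity
      rw [abs_of_nonneg h1, abs_pow (-1 : ℝ), abs_neg, abs_one, one_pow, one_mul,
        abs_of_nonneg (by positivity : 0 ≤ (Real.pi * r) ^ (2 * n)), Nat.abs_cast]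
    simp only [e]
    rw [integral_const_mul, integral_even_moment n hpi2]
    have h2 : √(Real.pi / Real.pi ^ 2) ≤ 1 := by
      refine Real.sqrt_le_iff.2 ⟨zero_le_one, ?_⟩
      rw [one_pow, div_le_one hpi2]
      nlinarith [Real.pi_gt_three]
    have h3 := abs_hermiteH_even_le n t
    have h4 := factorial_ratio_le_one n
    have hn := Nat.factorial_pos n
    have hn2 := Nat.factorial_pos (2 * n)
    have hpi := Real.pi_pos
    calc |hermiteH (2 * n) t| * (Real.pi * r) ^ (2 * n) / (2 * n).factorial *
          (√(Real.pi / Real.pi ^ 2) * ((2 * n).factorial / (4 ^ n * n.factorial * (Real.pi ^ 2) ^ n)))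
        = |hermiteH (2 * n) t| * (√(Real.pi / Real.pi ^ 2) * (r ^ 2) ^ n *
          (1 / (4 ^ n * n.factorial))) := by
          rw [mul_pow, ← pow_mul, ← pow_mul]
          field_simp
      _ ≤ (Real.exp (t ^ 2) * ((2 * n).factorial / n.factorial)) * (1 * (r ^ 2) ^ n *
          (1 / (4 ^ n * n.factorial))) := by gcongr
      _ = Real.exp (t ^ 2) * (r ^ 2) ^ n *
          (((2 * n).factorial : ℝ) / (4 ^ n * (n.factorial : ℝ) ^ 2)) := by
          field_simp
      _ ≤ Real.exp (t ^ 2) * (r ^ 2) ^ n * 1 := by gcongr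
      _ = _ := mul_one _
  have hsummable : Summable fun n => ∫ x, ‖F n x‖ :=
    Summable.of_nonneg_of_le (fun n => integral_nonneg fun x => norm_nonneg _) hnorm
      ((summable_geometric_of_lt_one (by positivity) (by nlinarith)).mul_left _)
  have hsum := hasSum_integral_of_summable_integral_norm hFint hsummable
  have hint : ∀ n, ∫ x, F n x =
      ((r ^ (2 * n) * hermiteh (2 * n) s * hermiteH (2 * n) t : ℝ) : ℂ) := by
    intro n
    have hsq : (√Real.pi : ℂ) ≠ 0 := by exact_mod_cast (Real.sqrt_pos.2 Real.pi_pos).ne'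
    have h1 := gaussDeriv_eq_fourier (2 * n) s
    have e : ∀ x, F n x = ((hermiteH (2 * n) t * r ^ (2 * n) /
        (2 ^ (2 * n) * (2 * n).factorial) : ℝ) : ℂ) *
        (Complex.exp (↑(-2 * Real.pi * x * s) * Complex.I) *
      ((-2 * Real.pi * Complex.I * x) ^ (2 * n) *
        Complex.exp (-Real.pi * Real.pi * (x : ℂ) ^ 2))) := by
      intro x
      have h2 : (-2 * Real.pi * Complex.I * x : ℂ) ^ (2 * n) =
          2 ^ (2 * n) * (-1) ^ n * (Real.pi : ℂ) ^ (2 * n) * (x : ℂ) ^ (2 * n) := by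
        rw [mul_pow, mul_pow, mul_pow, pow_mul Complex.I, Complex.I_sq, pow_mul (-2 : ℂ), neg_sq,
          ← pow_mul]
        ring
      have h3 : ((2 * n).factorial : ℂ) ≠ 0 := by exact_mod_cast (2 * n).factorial_ne_zero
      simp only [hF, ha]
      rw [h2]
      push_cast
      rw [show -(Real.pi : ℂ) ^ 2 * (x : ℂ) ^ 2 = -Real.pi * Real.pi * (x : ℂ) ^ 2 by ring]
      field_simp
      ring
    simp only [e]
    rw [integral_const_mul, hermiteh_eq_gaussDeriv]
    generalize (∫ x : ℝ, Complex.exp (↑(-2 * Real.pi * x * s) * Complex.I) *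
      ((-2 * Real.pi * Complex.I * x) ^ (2 * n) *
        Complex.exp (-Real.pi * Real.pi * (x : ℂ) ^ 2))) = J at h1 ⊢
    have h4 : ((2 * n).factorial : ℂ) ≠ 0 := by exact_mod_cast (2 * n).factorial_ne_zero
    push_cast
    rw [h1, pow_mul (-1 : ℂ), neg_one_sq, one_pow]
    field_simp
  -- Under the integral the series sums to `cos(2πrtx) e^{-π^2(1-r^2)x^2}` times the Fourier phase;
  -- splitting the cosine into exponentials shifts `s` by `∓rt`.
  have hlim : ∫ x, ∑' n, F n x =
      ((1 / 2 * (mehlerGauss r (s - r * t) + mehlerGauss r (s + r * t)) : ℝ) : ℂ) := by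
    have hexp : Integrable fun x : ℝ => Real.exp (-(Real.pi ^ 2 * (1 - r ^ 2)) * x ^ 2) :=
      integrable_exp_neg_mul_sq (by positivity)
    have hI : ∀ u : ℝ, Integrable fun x : ℝ =>
        Complex.exp (↑(-2 * Real.pi * x * u) * Complex.I) *
        ((Real.exp (-(Real.pi ^ 2 * (1 - r ^ 2)) * x ^ 2) : ℝ) : ℂ) := by
      intro u
      refine hexp.norm.mono' (Continuous.aestronglyMeasurable (by fun_prop))
        (.of_forall fun x => ?_)
      rw [norm_cexp_ofReal_mul_I_mul, Real.norm_eq_abs]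
    push_cast
    rw [mehlerGauss_eq_integral hr, mehlerGauss_eq_integral hr, ← integral_add (hI _) (hI _),
      ← integral_const_mul]
    refine integral_congr_ae (.of_forall fun x => ?_)
    have h1 := (hasSum_hermiteH_even t (Real.pi * r * x)).mul_right
      (Real.exp (-(Real.pi ^ 2) * x ^ 2))
    have h2 := (Complex.hasSum_ofReal.2 h1).mul_left
      (Complex.exp (↑(-2 * Real.pi * x * s) * Complex.I))
    refine h2.tsum_eq.trans ?_
    simp only
    rw [mul_assoc (Real.cos _), ← Real.exp_add,
      show (Real.pi * r * x) ^ 2 + -Real.pi ^ 2 * x ^ 2 = -(Real.pi ^ 2 * (1 - r ^ 2)) * x ^ 2 by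
        ring, Complex.ofReal_mul (Real.cos _), Complex.ofReal_cos, Complex.cos]
    have e1 : Complex.exp (↑(-2 * Real.pi * x * (s - r * t)) * Complex.I) =
        Complex.exp (↑(-2 * Real.pi * x * s) * Complex.I) *
          Complex.exp (↑(2 * t * (Real.pi * r * x)) * Complex.I) := by
      rw [← Complex.exp_add]
      congr 1
      push_cast
      ring
    have e2 : Complex.exp (↑(-2 * Real.pi * x * (s + r * t)) * Complex.I) =
        Complex.exp (↑(-2 * Real.pi * x * s) * Complex.I) *
          Complex.exp (-↑(2 * t * (Real.pi * r * x)) * Complex.I) := by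
      rw [← Complex.exp_add]
      congr 1
      push_cast
      ring
    simp only [e1, e2]
    push_cast
    ring
  rw [hlim] at hsum
  simp only [hint] at hsum
  exact_mod_cast hsum

end

/-! ### Abel summation of Hermite series -/

section

/-- The left side is the product of the bounds for the L¹ norm of `h_{2n}` and for `e^{-t^2}
|H_{2n}(t)|`. Its decay alone does not make the Hermite series of a bounded function summable. -/
lemma sqrt_factorial_div_le (n : ℕ) :
    √((2 * n).factorial : ℝ) / (2 ^ n * n.factorial) ≤ 1 / √(√(2 * n + 1)) := by
  have h := Real.sqrt_le_sqrt (factorial_ratio_le n)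
  rw [Real.sqrt_div (by positivity), Real.sqrt_div zero_le_one, Real.sqrt_one,
    Real.sqrt_mul (by positivity), Real.sqrt_sq (by positivity),
    show (4 : ℝ) ^ n = (2 ^ n) ^ 2 by rw [← pow_mul, mul_comm, pow_mul]; norm_num,
    Real.sqrt_sq (by positivity)] at h
  exact h

lemma sqrt_factorial_div_le_one (n : ℕ) :
    √((2 * n).factorial : ℝ) / (2 ^ n * n.factorial) ≤ 1 := by
  refine (sqrt_factorial_div_le n).trans ?_
  have h : (1 : ℝ) ≤ √(√(2 * n + 1)) := by
    rw [Real.one_le_sqrt, Real.one_le_sqrt]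
    linarith [(Nat.cast_nonneg n : (0 : ℝ) ≤ n)]
  rw [div_le_one (by linarith)]
  exact h

lemma integrable_hermiteh (n : ℕ) : Integrable (hermiteh n) := by
  rw [show hermiteh n = _ from funext (hermiteh_eq_gaussDeriv n)]
  exact (integrable_gaussDeriv n).const_mul _

lemma integral_abs_hermiteh_even_le (n : ℕ) :
    ∫ s, |hermiteh (2 * n) s| ≤ 1 / (2 ^ n * √((2 * n).factorial : ℝ)) := by
  have hpi := Real.sqrt_pos.2 Real.pi_pos
  have hf : (0 : ℝ) < (2 * n).factorial := by exact_mod_cast Nat.factorial_pos _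
  have hsf := Real.sqrt_pos.2 hf
  simp only [hermiteh_eq_gaussDeriv, abs_mul, abs_div, abs_pow, abs_neg, abs_one, one_pow]
  rw [integral_const_mul]
  have h := integral_abs_gaussDeriv_le (2 * n)
  rw [Real.sqrt_mul (by positivity), pow_mul', Real.sqrt_sq (by positivity)] at h
  rw [abs_of_pos hpi, Nat.abs_cast, Nat.abs_ofNat, pow_mul']
  refine (mul_le_mul_of_nonneg_left h (by positivity)).trans_eq ?_
  field_simp
  rw [Real.sq_sqrt hf.le]

variable {E : Type*} [NormedAddCommGroup E] [NormedSpace ℝ E]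

lemma integrable_smul_of_bounded {g : ℝ → ℝ} (hg : Integrable g) {f : ℝ → E} (hf : Continuous f)
    {M : ℝ} (hM : ∀ s, ‖f s‖ ≤ M) : Integrable fun s => g s • f s := by
  refine (hg.norm.mul_const M).mono' (hg.1.smul hf.aestronglyMeasurable) (.of_forall fun s => ?_)
  rw [norm_smul]
  exact mul_le_mul_of_nonneg_left (hM s) (norm_nonneg _)

lemma norm_integral_smul_le_of_bounded {g : ℝ → ℝ} (hg : Integrable g) {f : ℝ → E}
    {M : ℝ} (hM : ∀ s, ‖f s‖ ≤ M) : ‖∫ s, g s • f s‖ ≤ (∫ s, |g s|) * M := by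
  rw [← integral_mul_const]
  refine norm_integral_le_of_norm_le (hg.abs.mul_const M) (.of_forall fun s => ?_)
  rw [norm_smul, Real.norm_eq_abs]
  exact mul_le_mul_of_nonneg_left (hM s) (abs_nonneg _)

lemma integrable_mehlerGauss {r : ℝ} (hr : 0 < 1 - r ^ 2) : Integrable (mehlerGauss r) :=
  (integrable_exp_neg_sq_div hr).const_mul _

/-- Integration of an even function against the even Mehler kernel. -/
lemma integral_mehler_even {f : ℝ → E} (hf : Continuous f) {M : ℝ} (hM : ∀ s, ‖f s‖ ≤ M)
    (heven : ∀ s, f (-s) = f s) {r : ℝ} (hr : 0 < 1 - r ^ 2) (t : ℝ) :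
    ∫ s, (1 / 2 * (mehlerGauss r (s - r * t) + mehlerGauss r (s + r * t))) • f s =
      (√Real.pi)⁻¹ • ∫ y, Real.exp (-y ^ 2) • f (√(1 - r ^ 2) * y + r * t) := by
  have hg := integrable_mehlerGauss hr
  -- The reflection `s ↦ -s` exchanges the two kernels and leaves the even `f` unchanged.
  have h1 : ∫ s, mehlerGauss r (s + r * t) • f s = ∫ s, mehlerGauss r (s - r * t) • f s := by
    rw [← integral_neg_eq_self]
    refine integral_congr_ae (.of_forall fun s => ?_)
    simp only [heven, mehlerGauss]
    congr 4
    ring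
  have h2 : ∫ s, mehlerGauss r (s - r * t) • f s = ∫ u, mehlerGauss r u • f (u + r * t) := by
    rw [← integral_add_right_eq_self _ (r * t)]
    simp
  have h3 : ∫ u, mehlerGauss r u • f (u + r * t) =
      √(1 - r ^ 2) • ∫ y, mehlerGauss r (√(1 - r ^ 2) * y) • f (√(1 - r ^ 2) * y + r * t) := by
    rw [Measure.integral_comp_mul_left (fun u => mehlerGauss r u • f (u + r * t)), smul_smul,
      abs_of_pos (inv_pos.2 (Real.sqrt_pos.2 hr)), mul_inv_cancel₀ (Real.sqrt_pos.2 hr).ne',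
      one_smul]
  have i1 := integrable_smul_of_bounded (hg.comp_sub_right (r * t)) hf hM
  have i2 := integrable_smul_of_bounded (hg.comp_add_right (r * t)) hf hM
  calc _ = ∫ s, (1 / 2 : ℝ) • (mehlerGauss r (s - r * t) • f s + mehlerGauss r (s + r * t) • f s) := by
        refine integral_congr_ae (.of_forall fun s => ?_)
        simp only [mul_smul, add_smul]
    _ = ∫ s, mehlerGauss r (s - r * t) • f s := by
        rw [integral_smul, integral_add i1 i2, h1, ← two_smul ℝ, smul_smul]
        norm_num
    _ = _ := by
        rw [h2, h3, ← integral_smul, ← integral_smul]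
        refine integral_congr_ae (.of_forall fun y => ?_)
        have h4 := Real.sqrt_pos.2 hr
        have h5 := Real.sqrt_pos.2 Real.pi_pos
        simp only [mehlerGauss, smul_smul, mul_pow, Real.sq_sqrt hr.le]
        rw [Real.sqrt_mul Real.pi_pos.le, mul_div_cancel_left₀ _ hr.ne']
        congr 1
        field_simp

/-- After rescaling, `r` occurs only inside the bounded continuous `f`, whose argument tends to `t`
for each `y`; dominated convergence applies. -/
lemma tendsto_integral_mehler {f : ℝ → E} (hf : Continuous f) {M : ℝ} (hM : ∀ s, ‖f s‖ ≤ M)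
    [CompleteSpace E] (t : ℝ) :
    Tendsto (fun r : ℝ => (√Real.pi)⁻¹ • ∫ y, Real.exp (-y ^ 2) • f (√(1 - r ^ 2) * y + r * t))
      (𝓝[<] 1) (𝓝 (f t)) := by
  have hi0 : Integrable fun t : ℝ => Real.exp (-t ^ 2) := by
    simpa using integrable_exp_neg_mul_sq one_pos
  have hlim : Tendsto (fun r : ℝ => ∫ y, Real.exp (-y ^ 2) • f (√(1 - r ^ 2) * y + r * t))
      (𝓝[<] 1) (𝓝 (∫ y, Real.exp (-y ^ 2) • f t)) := by
    refine tendsto_integral_filter_of_dominated_convergence (fun y => Real.exp (-y ^ 2) * M)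
      (.of_forall fun r => ?_) (.of_forall fun r => .of_forall fun y => ?_) (hi0.mul_const M)
      (.of_forall fun y => ?_)
    · exact Continuous.aestronglyMeasurable (by fun_prop)
    · rw [norm_smul, Real.norm_eq_abs, Real.abs_exp]
      exact mul_le_mul_of_nonneg_left (hM _) (Real.exp_pos _).le
    · have hc : Continuous fun r : ℝ => Real.exp (-y ^ 2) • f (√(1 - r ^ 2) * y + r * t) := by
        fun_prop
      have := hc.tendsto 1
      simp only [one_pow, sub_self, Real.sqrt_zero, zero_mul, one_mul, zero_add] at this
      exact this.mono_left nhdsWithin_le_nhds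
  have h := hlim.const_smul (√Real.pi)⁻¹
  rwa [integral_smul_const, integral_exp_neg_sq, smul_smul,
    inv_mul_cancel₀ (Real.sqrt_pos.2 Real.pi_pos).ne', one_smul] at h

/-- An even bounded continuous function is the sum of its Hermite series wherever that series
converges absolutely. -/
lemma hasSum_hermite_series [CompleteSpace E] {f : ℝ → E} (hf : Continuous f) {M : ℝ}
    (hM : ∀ s, ‖f s‖ ≤ M) (heven : ∀ s, f (-s) = f s) (t : ℝ)
    (hsum : Summable fun n : ℕ => ‖hermiteH (2 * n) t • ∫ s, hermiteh (2 * n) s • f s‖) :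
    HasSum (fun n : ℕ => hermiteH (2 * n) t • ∫ s, hermiteh (2 * n) s • f s) (f t) := by
  have hM0 : 0 ≤ M := (norm_nonneg _).trans (hM 0)
  -- The factors `r^{2n}` make the exchange of sum and integral legitimate without the summability
  -- hypothesis.
  have habel : ∀ r : ℝ, 0 ≤ r → r < 1 →
      HasSum (fun n : ℕ => r ^ (2 * n) • hermiteH (2 * n) t • ∫ s, hermiteh (2 * n) s • f s)
        ((√Real.pi)⁻¹ • ∫ y, Real.exp (-y ^ 2) • f (√(1 - r ^ 2) * y + r * t)) := by
    intro r hr0 hr1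
    have hr : 0 < 1 - r ^ 2 := by nlinarith
    set F : ℕ → ℝ → E := fun n s =>
      (r ^ (2 * n) * hermiteh (2 * n) s * hermiteH (2 * n) t) • f s with hF
    have hgi : ∀ n : ℕ, Integrable fun s => r ^ (2 * n) * hermiteh (2 * n) s * hermiteH (2 * n) t :=
      fun n => ((integrable_hermiteh _).const_mul _).mul_const _
    have hFi : ∀ n, Integrable (F n) := fun n => integrable_smul_of_bounded (hgi n) hf hM
    have hbd : ∀ n, ∫ s, ‖F n s‖ ≤ (Real.exp (t ^ 2) * M) * (r ^ 2) ^ n := by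
      intro n
      have hf0 : (0 : ℝ) < (2 * n).factorial := by exact_mod_cast Nat.factorial_pos _
      have hsf := Real.sqrt_pos.2 hf0
      have hn : (0 : ℝ) < n.factorial := by exact_mod_cast Nat.factorial_pos _
      calc ∫ s, ‖F n s‖
          ≤ ∫ s, (r ^ (2 * n) * |hermiteH (2 * n) t| * M) * |hermiteh (2 * n) s| := by
            refine integral_mono (hFi n).norm ((integrable_hermiteh _).abs.const_mul _) fun s => ?_
            simp only [hF]
            rw [norm_smul, Real.norm_eq_abs, abs_mul, abs_mul,
              abs_of_nonneg (by positivity : 0 ≤ r ^ (2 * n))]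
            refine (mul_le_mul_of_nonneg_left (hM s) (by positivity)).trans_eq ?_
            ring
        _ ≤ (r ^ (2 * n) * (Real.exp (t ^ 2) * ((2 * n).factorial / n.factorial)) * M) *
            (1 / (2 ^ n * √((2 * n).factorial : ℝ))) := by
            rw [integral_const_mul]
            have h1 := abs_hermiteH_even_le n t
            have h2 := integral_abs_hermiteh_even_le n
            gcongr
        _ = ((Real.exp (t ^ 2) * M) * (r ^ 2) ^ n) *
            (√((2 * n).factorial : ℝ) / (2 ^ n * n.factorial)) := by
            rw [pow_mul]
            field_simp
            rw [Real.sq_sqrt hf0.le]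
            ring
        _ ≤ ((Real.exp (t ^ 2) * M) * (r ^ 2) ^ n) * 1 := by
            have := sqrt_factorial_div_le_one n
            gcongr
        _ = _ := mul_one _
    have h := hasSum_integral_of_summable_integral_norm hFi
      (Summable.of_nonneg_of_le (fun n => integral_nonneg fun x => norm_nonneg _) hbd
        ((summable_geometric_of_lt_one (by positivity) (by nlinarith)).mul_left _))
    rw [← integral_mehler_even hf hM heven hr]
    convert! h using 1
    · ext n
      rw [← integral_smul, ← integral_smul]
      refine integral_congr_ae (.of_forall fun s => ?_)
      simp only [hF, smul_smul]
      ring_nf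
    · refine integral_congr_ae (.of_forall fun s => ?_)
      exact (((hasSum_mehler_even hr0 hr1 s t).smul_const (f s)).tsum_eq).symm
  have hev : ∀ᶠ r : ℝ in 𝓝[<] 1, 0 ≤ r ∧ r < 1 := by
    filter_upwards [Ioo_mem_nhdsLT (zero_lt_one : (0 : ℝ) < 1)] with r hr
    exact ⟨hr.1.le, hr.2⟩
  -- Here summability enters: the terms at `r = 1` dominate those at `r < 1`.
  have h1 := tendsto_tsum_of_dominated_convergence (𝓕 := 𝓝[<] (1 : ℝ)) hsum
    (f := fun r (n : ℕ) => r ^ (2 * n) • hermiteH (2 * n) t • ∫ s, hermiteh (2 * n) s • f s)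
    (g := fun n => hermiteH (2 * n) t • ∫ s, hermiteh (2 * n) s • f s)
    (fun n => by
      have hc : Continuous fun r : ℝ =>
        r ^ (2 * n) • hermiteH (2 * n) t • ∫ s, hermiteh (2 * n) s • f s := by fun_prop
      have := hc.tendsto 1
      rw [one_pow, one_smul] at this
      exact this.mono_left nhdsWithin_le_nhds)
    (by
      filter_upwards [hev] with r hr n
      rw [norm_smul, Real.norm_eq_abs, abs_of_nonneg (pow_nonneg hr.1 _)]
      exact mul_le_of_le_one_left (norm_nonneg _) (pow_le_one₀ hr.1 hr.2.le))
  have h2 := (tendsto_integral_mehler hf hM t).congr'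
    (hev.mono fun r hr => (habel r hr.1 hr.2).tsum_eq.symm)
  rw [tendsto_nhds_unique h2 h1]
  exact hsum.of_norm.hasSum

end

/-! ### Second differences of Gaussian derivatives -/

section

/-- The mean value inequality applied twice, which costs only the factor `1/2` of Taylor's formula.
-/
lemma abs_le_of_abs_second_deriv_le {ψ ψ' ψ'' : ℝ → ℝ} (h1 : ∀ u, HasDerivAt ψ (ψ' u) u)
    (h2 : ∀ u, HasDerivAt ψ' (ψ'' u) u) (h0 : ψ 0 = 0) (h0' : ψ' 0 = 0) {h B : ℝ}
    (hB : ∀ u, |u| ≤ |h| → |ψ'' u| ≤ B) : |ψ h| ≤ B * h ^ 2 := by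
  have hB0 : 0 ≤ B := (abs_nonneg _).trans (hB h le_rfl)
  have hconv : Convex ℝ (Metric.closedBall (0 : ℝ) |h|) := convex_closedBall _ _
  have hmem : ∀ u : ℝ, u ∈ Metric.closedBall (0 : ℝ) |h| ↔ |u| ≤ |h| := fun u => by
    rw [mem_closedBall_zero_iff, Real.norm_eq_abs]
  have hz : (0 : ℝ) ∈ Metric.closedBall (0 : ℝ) |h| := (hmem 0).2 (by simp)
  have b1 : ∀ u, |u| ≤ |h| → |ψ' u| ≤ B * |h| := by
    intro u hu
    have := hconv.norm_image_sub_le_of_norm_hasDerivWithin_le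
      (fun v _ => (h2 v).hasDerivWithinAt) (fun v hv => hB v ((hmem v).1 hv)) hz ((hmem u).2 hu)
    rw [h0', sub_zero, sub_zero, Real.norm_eq_abs, Real.norm_eq_abs] at this
    exact this.trans (mul_le_mul_of_nonneg_left hu hB0)
  have := hconv.norm_image_sub_le_of_norm_hasDerivWithin_le
    (fun v _ => (h1 v).hasDerivWithinAt) (fun v hv => b1 v ((hmem v).1 hv)) hz ((hmem h).2 le_rfl)
  rw [h0, sub_zero, sub_zero, Real.norm_eq_abs, Real.norm_eq_abs] at this
  refine this.trans_eq ?_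
  rw [mul_assoc, ← sq, sq_abs]

/-- The second difference quotient of a derivative of the Gaussian. -/
def gaussSecondDiff (n : ℕ) (h t : ℝ) : ℝ :=
  (h ^ 2)⁻¹ * (gaussDeriv n (t + h) + gaussDeriv n (t - h) - 2 * gaussDeriv n t)

lemma continuous_gaussSecondDiff (n : ℕ) (h : ℝ) : Continuous (gaussSecondDiff n h) := by
  have := continuous_gaussDeriv n
  unfold gaussSecondDiff
  fun_prop

/-- Subtracting `u^2 a` from the symmetric second difference keeps value and slope zero at `u = 0`.
The choice `a = 0` gives a dominating function, `a = gaussDeriv (n + 2) t` the limit. -/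
lemma abs_gaussSecondDiff_sub_le (n : ℕ) {h : ℝ} (t a B : ℝ) (hh : h ≠ 0)
    (hB : ∀ u, |u| ≤ |h| →
      |gaussDeriv (n + 2) (t + u) + gaussDeriv (n + 2) (t - u) - 2 * a| ≤ B) :
    |gaussSecondDiff n h t - a| ≤ B := by
  have h2 : 0 < h ^ 2 := by positivity
  have key := abs_le_of_abs_second_deriv_le
    (ψ := fun u => gaussDeriv n (t + u) + gaussDeriv n (t - u) - 2 * gaussDeriv n t - u ^ 2 * a)
    (ψ' := fun u => gaussDeriv (n + 1) (t + u) - gaussDeriv (n + 1) (t - u) - 2 * u * a)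
    (ψ'' := fun u => gaussDeriv (n + 2) (t + u) + gaussDeriv (n + 2) (t - u) - 2 * a)
    (fun u => by
      have e1 := (hasDerivAt_gaussDeriv n (t + u)).comp_const_add t u
      have e2 := (hasDerivAt_gaussDeriv n (t - u)).comp_const_sub t u
      have e3 := (hasDerivAt_pow 2 u).mul_const a
      convert! ((e1.add e2).sub_const (2 * gaussDeriv n t)).sub e3 using 1
      simp
      ring)
    (fun u => by
      have e1 := (hasDerivAt_gaussDeriv (n + 1) (t + u)).comp_const_add t u
      have e2 := (hasDerivAt_gaussDeriv (n + 1) (t - u)).comp_const_sub t u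
      have e3 := ((hasDerivAt_id u).const_mul 2).mul_const a
      convert! (e1.sub e2).sub e3 using 1
      ring)
    (by simp; ring) (by simp) hB
  have e : gaussSecondDiff n h t - a = (h ^ 2)⁻¹ *
      (gaussDeriv n (t + h) + gaussDeriv n (t - h) - 2 * gaussDeriv n t - h ^ 2 * a) := by
    rw [gaussSecondDiff]
    field_simp
  rw [e, abs_mul, abs_of_pos (inv_pos.2 h2), inv_mul_le_iff₀ h2]
  exact key.trans_eq (mul_comm _ _)

lemma exists_abs_gaussSecondDiff_le (n : ℕ) :
    ∃ K : ℝ, ∀ h, h ≠ 0 → |h| ≤ 1 → ∀ t, |gaussSecondDiff n h t| ≤ K * Real.exp (-(t ^ 2 / 4)) := by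
  obtain ⟨K, hK, hbd⟩ := exists_abs_gaussDeriv_le (n + 2)
  refine ⟨2 * (K * Real.exp (1 / 2)), fun h hh hh1 t => ?_⟩
  have key : ∀ v, |v| ≤ 1 → |gaussDeriv (n + 2) (t + v)| ≤
      K * Real.exp (1 / 2) * Real.exp (-(t ^ 2 / 4)) := by
    intro v hv
    refine (hbd _).trans ?_
    rw [mul_assoc, ← Real.exp_add]
    refine mul_le_mul_of_nonneg_left (Real.exp_le_exp.2 ?_) hK
    have : v ^ 2 ≤ 1 := by rw [← sq_abs]; exact pow_le_one₀ (abs_nonneg v) hv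
    -- Since `(t+v)^2/2 - t^2/4 + v^2/2 = (t+2v)^2/4` and `v^2 ≤ 1`, a shift costs the factor
    -- `e^{1/2}` and half of the exponent.
    nlinarith [sq_nonneg (t + 2 * v)]
  have := abs_gaussSecondDiff_sub_le n t 0
    (2 * (K * Real.exp (1 / 2)) * Real.exp (-(t ^ 2 / 4))) hh fun u hu => by
      have k1 := key u (hu.trans hh1)
      have k2 := key (-u) (by rw [abs_neg]; exact hu.trans hh1)
      rw [← sub_eq_add_neg] at k2
      rw [mul_zero, sub_zero]
      refine (abs_add_le _ _).trans ?_
      linarith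
  rwa [sub_zero] at this

lemma tendsto_gaussSecondDiff (n : ℕ) (t : ℝ) :
    Tendsto (fun h => gaussSecondDiff n h t) (𝓝[≠] 0) (𝓝 (gaussDeriv (n + 2) t)) := by
  rw [Metric.tendsto_nhds]
  intro ε hε
  have hc : Continuous fun u => gaussDeriv (n + 2) (t + u) + gaussDeriv (n + 2) (t - u) -
      2 * gaussDeriv (n + 2) t := by
    have := continuous_gaussDeriv (n + 2)
    fun_prop
  have hl := hc.tendsto 0
  rw [add_zero, sub_zero, ← two_mul, sub_self, Metric.tendsto_nhds_nhds] at hl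
  obtain ⟨δ, hδ, hd⟩ := hl (ε / 2) (by positivity)
  have : ∀ᶠ h : ℝ in 𝓝[≠] 0, h ∈ Metric.ball (0 : ℝ) δ ∧ h ≠ 0 :=
    Filter.Eventually.and (nhdsWithin_le_nhds (Metric.ball_mem_nhds 0 hδ)) self_mem_nhdsWithin
  filter_upwards [this] with h hh
  rw [Real.dist_eq]
  refine lt_of_le_of_lt (abs_gaussSecondDiff_sub_le n t _ (ε / 2) hh.2 fun u hu => ?_) (by linarith)
  have h1 : dist u 0 < δ := by
    rw [Real.dist_eq, sub_zero]
    refine lt_of_le_of_lt hu ?_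
    simpa [Real.dist_eq] using hh.1
  have := hd h1
  rw [Real.dist_eq, sub_zero] at this
  exact this.le

section

variable {E : Type*} [NormedAddCommGroup E] [NormedSpace ℝ E]

lemma tendsto_integral_gaussSecondDiff (n : ℕ) {f : ℝ → E} (hf : Continuous f) {M : ℝ}
    (hM : ∀ s, ‖f s‖ ≤ M) :
    Tendsto (fun h => ∫ t, gaussSecondDiff n h t • f t) (𝓝[≠] 0)
      (𝓝 (∫ t, gaussDeriv (n + 2) t • f t)) := by
  obtain ⟨K, hK⟩ := exists_abs_gaussSecondDiff_le n
  have hM0 : 0 ≤ M := (norm_nonneg _).trans (hM 0)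
  have hev : ∀ᶠ h : ℝ in 𝓝[≠] 0, h ∈ Metric.closedBall (0 : ℝ) 1 ∧ h ≠ 0 :=
    Filter.Eventually.and (nhdsWithin_le_nhds (Metric.closedBall_mem_nhds 0 one_pos)) self_mem_nhdsWithin
  refine tendsto_integral_filter_of_dominated_convergence
    (fun t => K * Real.exp (-(t ^ 2 / 4)) * M)
    (.of_forall fun h =>
      ((continuous_gaussSecondDiff n h).smul hf).aestronglyMeasurable) ?_
    (((integrable_exp_neg_sq_div (by norm_num)).const_mul K).mul_const M)
    (.of_forall fun t => (tendsto_gaussSecondDiff n t).smul_const _)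
  filter_upwards [hev] with h hh
  refine .of_forall fun t => ?_
  rw [norm_smul, Real.norm_eq_abs]
  have := hK h hh.2 (by simpa using hh.1) t
  exact mul_le_mul this (hM t) (norm_nonneg _) ((abs_nonneg _).trans this)

/-- Summation by parts: the second difference moves from the Gaussian to the function. -/
lemma integral_gaussSecondDiff_smul (n : ℕ) {f : ℝ → E} (hf : Continuous f) {M : ℝ}
    (hM : ∀ s, ‖f s‖ ≤ M) (h : ℝ) :
    ∫ t, gaussSecondDiff n h t • f t =
      ∫ t, gaussDeriv n t • (h ^ 2)⁻¹ • (f (t + h) + f (t - h) - (2 : ℝ) • f t) := by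
  have hg := integrable_gaussDeriv n
  have i1 := integrable_smul_of_bounded (hg.comp_add_right h) hf hM
  have i2 := integrable_smul_of_bounded (hg.comp_sub_right h) hf hM
  have i3 := integrable_smul_of_bounded hg hf hM
  have j1 := integrable_smul_of_bounded hg (f := fun t => f (t + h)) (by fun_prop) fun s => hM _
  have j2 := integrable_smul_of_bounded hg (f := fun t => f (t - h)) (by fun_prop) fun s => hM _
  have e1 : ∫ t, gaussDeriv n (t + h) • f t = ∫ t, gaussDeriv n t • f (t - h) := by
    rw [← integral_sub_right_eq_self _ h]
    simp
  have e2 : ∫ t, gaussDeriv n (t - h) • f t = ∫ t, gaussDeriv n t • f (t + h) := by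
    rw [← integral_add_right_eq_self _ h]
    simp
  have q1 := integral_sub (f := fun t => gaussDeriv n (t + h) • f t + gaussDeriv n (t - h) • f t)
    (g := fun t => (2 : ℝ) • gaussDeriv n t • f t) (i1.add i2) (i3.smul _)
  have q2 := integral_sub (f := fun t => gaussDeriv n t • f (t + h) + gaussDeriv n t • f (t - h))
    (g := fun t => (2 : ℝ) • gaussDeriv n t • f t) (j1.add j2) (i3.smul _)
  calc ∫ t, gaussSecondDiff n h t • f t
      = ∫ t, (h ^ 2)⁻¹ • (gaussDeriv n (t + h) • f t + gaussDeriv n (t - h) • f t -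
          (2 : ℝ) • gaussDeriv n t • f t) := by
        refine integral_congr_ae (.of_forall fun t => ?_)
        simp only [gaussSecondDiff]
        module
    _ = ∫ t, (h ^ 2)⁻¹ • (gaussDeriv n t • f (t + h) + gaussDeriv n t • f (t - h) -
          (2 : ℝ) • gaussDeriv n t • f t) := by
        rw [integral_smul, integral_smul, q1, q2, integral_add i1 i2, integral_add j1 j2, e1, e2,
          add_comm (∫ t, gaussDeriv n t • f (t - h))]
    _ = _ := by
        refine integral_congr_ae (.of_forall fun t => ?_)
        simp only
        module

end

/-! ### Cosine functions paired with Gaussian derivatives, and powers of the generator -/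

variable {X : Type*} [NormedAddCommGroup X] [NormedSpace ℂ X]

namespace IsCosineFunction

variable {C : ℝ → X →L[ℂ] X}

lemma map_neg (hC : IsCosineFunction C) (t : ℝ) : C (-t) = C t := by
  have h := hC.add_add_sub 0 t
  rw [zero_add, zero_sub, hC.map_zero, ContinuousLinearMap.id_comp, two_smul] at h
  exact add_left_cancel h

lemma add_add_sub_apply (hC : IsCosineFunction C) (t s : ℝ) (x : X) :
    C (t + s) x + C (t - s) x = (2 : ℝ) • C t (C s x) := by
  have h := congrArg (fun L : X →L[ℂ] X => L x) (hC.add_add_sub t s)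
  simp only [_root_.add_apply, _root_.smul_apply,
    ContinuousLinearMap.comp_apply] at h
  rw [h, two_smul, two_smul]

/-- By evenness, the left side of the functional equation is symmetric in `t` and `s`. -/
lemma comm_apply (hC : IsCosineFunction C) (t s : ℝ) (x : X) : C t (C s x) = C s (C t x) := by
  have h1 := hC.add_add_sub_apply t s x
  have h2 := hC.add_add_sub_apply s t x
  rw [← neg_sub t s, hC.map_neg, add_comm s t, h1] at h2
  exact smul_right_injective X (two_ne_zero : (2 : ℝ) ≠ 0) h2

lemma norm_apply_le {M : ℝ} (hM : ∀ t, ‖C t‖ ≤ M) (t : ℝ) (x : X) : ‖C t x‖ ≤ M * ‖x‖ :=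
  (C t).le_of_opNorm_le (hM t) x

end IsCosineFunction

/-- The pairing of a cosine function with the derivatives of the Gaussian. -/
def gaussCoeff (C : ℝ → X →L[ℂ] X) (n : ℕ) (x : X) : X := ∫ t, gaussDeriv n t • C t x

variable {C : ℝ → X →L[ℂ] X}

lemma generator_apply_eq {x y : X}
    (h : Tendsto (fun t : ℝ => (2 / t ^ 2) • (C t x - x)) (𝓝[≠] 0) (𝓝 y)) :
    ∃ hx : x ∈ (generator C).domain, generator C ⟨x, hx⟩ = y :=
  ⟨⟨y, h⟩, tendsto_nhds_unique (⟨y, h⟩ : x ∈ (generator C).domain).choose_spec h⟩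

lemma tendsto_generator (x : (generator C).domain) :
    Tendsto (fun t : ℝ => (2 / t ^ 2) • (C t x - x)) (𝓝[≠] 0) (𝓝 (generator C x)) :=
  x.2.choose_spec

lemma integrable_gaussDeriv_smul (hC : IsCosineFunction C) {M : ℝ} (hM : ∀ t, ‖C t‖ ≤ M) (n : ℕ)
    (x : X) : Integrable fun t => gaussDeriv n t • C t x :=
  integrable_smul_of_bounded (integrable_gaussDeriv n) (hC.strong_cont x)
    fun s => IsCosineFunction.norm_apply_le hM s x

lemma norm_gaussCoeff_le {M : ℝ} (hM : ∀ t, ‖C t‖ ≤ M) (n : ℕ) (x : X) :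
    ‖gaussCoeff C n x‖ ≤ √Real.pi * √(2 ^ n * n.factorial) * (M * ‖x‖) := by
  have hM0 : 0 ≤ M := (norm_nonneg _).trans (hM 0)
  refine (norm_integral_smul_le_of_bounded (integrable_gaussDeriv n)
    fun s => IsCosineFunction.norm_apply_le hM s x).trans ?_
  exact mul_le_mul_of_nonneg_right (integral_abs_gaussDeriv_le n) (by positivity)

lemma gaussCoeff_sub (hC : IsCosineFunction C) {M : ℝ} (hM : ∀ t, ‖C t‖ ≤ M) (n : ℕ) (x y : X) :
    gaussCoeff C n (x - y) = gaussCoeff C n x - gaussCoeff C n y := by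
  simp only [gaussCoeff, map_sub, smul_sub]
  exact integral_sub (integrable_gaussDeriv_smul hC hM n x) (integrable_gaussDeriv_smul hC hM n y)

/-- The integral of `C(·) x` against the second difference of the Gaussian derivative has two limits
as `h → 0`. Directly it tends to the pairing of index `n + 2`; after summation by parts it is the
pairing of index `n` at `(2/h^2)(C(h)x - x)`, which tends to the one at `A x`. -/
lemma gaussCoeff_generator (hC : IsCosineFunction C) {M : ℝ} (hM : ∀ t, ‖C t‖ ≤ M) (n : ℕ)
    (x : (generator C).domain) :
    gaussCoeff C (n + 2) (x : X) = gaussCoeff C n (generator C x) := by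
  have h1 := tendsto_integral_gaussSecondDiff n (hC.strong_cont (x : X))
    fun s => IsCosineFunction.norm_apply_le hM s (x : X)
  have h2 : ∀ h, ∫ t, gaussSecondDiff n h t • C t (x : X) =
      gaussCoeff C n ((2 / h ^ 2) • (C h x - x)) := by
    intro h
    rw [integral_gaussSecondDiff_smul n (hC.strong_cont (x : X))
      (fun s => IsCosineFunction.norm_apply_le hM s (x : X))]
    refine integral_congr_ae (.of_forall fun t => ?_)
    simp only [hC.add_add_sub_apply, ContinuousLinearMap.map_smul_of_tower, map_sub]
    module
  have h3 : Tendsto (fun h => gaussCoeff C n ((2 / h ^ 2) • (C h x - x))) (𝓝[≠] 0)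
      (𝓝 (gaussCoeff C n (generator C x))) := by
    rw [tendsto_iff_norm_sub_tendsto_zero]
    have h4 := tendsto_iff_norm_sub_tendsto_zero.1 (tendsto_generator x)
    have h5 := (h4.const_mul M).const_mul (√Real.pi * √(2 ^ n * n.factorial))
    rw [mul_zero, mul_zero] at h5
    refine squeeze_zero (fun _ => norm_nonneg _) (fun h => ?_) h5
    rw [← gaussCoeff_sub hC hM]
    exact norm_gaussCoeff_le hM n _
  simp only [h2] at h1
  exact tendsto_nhds_unique h1 h3

/-- Here `x` is arbitrary: `C(h)` passes under the integral, and the difference quotient of the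
pairing is moved onto the smooth Gaussian factor. The scalar `a` makes room for the normalization of
`T(1/4)`. -/
lemma generator_gaussCoeff [CompleteSpace X] (hC : IsCosineFunction C) {M : ℝ}
    (hM : ∀ t, ‖C t‖ ≤ M) (n : ℕ) (a : ℝ) (x : X) :
    ∃ h : a • gaussCoeff C n x ∈ (generator C).domain,
      generator C ⟨a • gaussCoeff C n x, h⟩ = a • gaussCoeff C (n + 2) x := by
  refine generator_apply_eq ?_
  have h1 := (tendsto_integral_gaussSecondDiff n (hC.strong_cont x)
    fun s => IsCosineFunction.norm_apply_le hM s x).const_smul a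
  refine h1.congr fun h => ?_
  have hi := integrable_gaussDeriv_smul hC hM n x
  rw [ContinuousLinearMap.map_smul_of_tower, ← smul_sub, smul_comm]
  congr 1
  rw [gaussCoeff, ← (C h).integral_comp_comm hi,
    ← integral_sub ((C h).integrable_comp hi) hi, ← integral_smul,
    integral_gaussSecondDiff_smul n (hC.strong_cont x)
      (fun s => IsCosineFunction.norm_apply_le hM s x)]
  refine integral_congr_ae (.of_forall fun t => ?_)
  simp only [hC.add_add_sub_apply, ContinuousLinearMap.map_smul_of_tower, hC.comm_apply t h]
  module

lemma gaussCoeff_opPow (hC : IsCosineFunction C) {M : ℝ} (hM : ∀ t, ‖C t‖ ≤ M) (p n : ℕ)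
    (x : (opPow (generator C) p).domain) :
    gaussCoeff C (n + 2 * p) (x : X) = gaussCoeff C n (opPow (generator C) p x) := by
  induction p generalizing n with
  | zero => rfl
  | succ p ih =>
    obtain ⟨x, hx, hx'⟩ := x
    have e : opPow (generator C) (p + 1) ⟨x, hx, hx'⟩ =
      generator C ⟨opPow (generator C) p ⟨x, hx⟩, hx'⟩ := rfl
    rw [e, ← gaussCoeff_generator hC hM, ← ih (n + 2) ⟨x, hx⟩]
    congr 1
    ring

lemma integral_Ioi_add_of_even {E : Type*} [NormedAddCommGroup E] [NormedSpace ℝ E] {f : ℝ → E}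
    (hf : Integrable f) (heven : ∀ t, f (-t) = f t) :
    ∫ t, f t = (2 : ℝ) • ∫ t in Set.Ioi (0 : ℝ), f t := by
  rw [← intervalIntegral.integral_Iic_add_Ioi (b := 0) hf.integrableOn hf.integrableOn]
  have := integral_comp_neg_Iic 0 f
  simp only [heven, neg_zero] at this
  rw [this, two_smul]

/-- At `z = 1/4` the kernel is `e^{-t^2}`; the factor `2` from `√(π/4) = √π/2` extends the half-line
integral of an even function to the line. -/
lemma semigroup_quarter_eq (hC : IsCosineFunction C) {M : ℝ} (hM : ∀ t, ‖C t‖ ≤ M) (x : X) :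
    semigroup C (1 / 4) x = (√Real.pi)⁻¹ • gaussCoeff C 0 x := by
  have hi := integrable_gaussDeriv_smul hC hM 0 x
  rw [gaussCoeff, integral_Ioi_add_of_even hi (fun t => by
    simp only [gaussDeriv_zero, hC.map_neg, neg_sq]), semigroup]
  have e : ∀ t : ℝ, Complex.exp (-(t : ℂ) ^ 2 / (4 * (1 / 4))) • C t x = gaussDeriv 0 t • C t x := by
    intro t
    rw [gaussDeriv_zero, ← Complex.coe_smul]
    congr 1
    push_cast
    congr 1
    ring
  simp only [e]
  have e2 : (1 / (Real.pi * (1 / 4 : ℂ)) ^ (1 / 2 : ℂ)) = (((√Real.pi)⁻¹ * 2 : ℝ) : ℂ) := by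
    have h4 : (Real.pi * (1 / 4 : ℂ)) = ((Real.pi / 4 : ℝ) : ℂ) := by push_cast; ring
    have h5 : ((Real.pi / 4 : ℝ) : ℂ) ^ (1 / 2 : ℂ) = ((√(Real.pi / 4) : ℝ) : ℂ) := by
      rw [Real.sqrt_eq_rpow, Complex.ofReal_cpow (by positivity)]
      norm_num
    have h6 : √(Real.pi / 4) = √Real.pi / 2 := by
      rw [Real.sqrt_div Real.pi_pos.le, show (4 : ℝ) = 2 ^ 2 by norm_num, Real.sqrt_sq two_pos.le]
    rw [h4, h5, h6]
    push_cast
    field_simp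
  rw [e2, Complex.coe_smul, smul_smul]

lemma opPow_semigroup [CompleteSpace X] (hC : IsCosineFunction C) {M : ℝ} (hM : ∀ t, ‖C t‖ ≤ M)
    (n : ℕ) (x : X) :
    ∃ h : semigroup C (1 / 4) x ∈ (opPow (generator C) n).domain,
      opPow (generator C) n ⟨semigroup C (1 / 4) x, h⟩ =
        (√Real.pi)⁻¹ • gaussCoeff C (2 * n) x := by
  induction n with
  | zero => exact ⟨Submodule.mem_top, semigroup_quarter_eq hC hM x⟩
  | succ n ih =>
    obtain ⟨h, he⟩ := ih
    obtain ⟨h', he'⟩ := generator_gaussCoeff hC hM (2 * n) (√Real.pi)⁻¹ x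
    have h2 : opPow (generator C) n ⟨semigroup C (1 / 4) x, h⟩ ∈ (generator C).domain := by
      rw [he]; exact h'
    refine ⟨⟨h, h2⟩, ?_⟩
    have e : opPow (generator C) (n + 1) ⟨semigroup C (1 / 4) x, h, h2⟩ =
      generator C ⟨opPow (generator C) n ⟨semigroup C (1 / 4) x, h⟩, h2⟩ := rfl
    rw [e, show 2 * (n + 1) = 2 * n + 2 by ring, ← he']
    congr 1
    exact Subtype.ext he

lemma powApply_semigroup [CompleteSpace X] (hC : IsCosineFunction C) {M : ℝ} (hM : ∀ t, ‖C t‖ ≤ M)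
    (n : ℕ) (x : X) :
    powApply (generator C) n (semigroup C (1 / 4) x) = (√Real.pi)⁻¹ • gaussCoeff C (2 * n) x := by
  obtain ⟨h, he⟩ := opPow_semigroup hC hM n x
  -- Since `T(1/4) x` lies in every `D(A^n)`, the default value `0` of `powApply` does not occur.
  rw [powApply, dif_pos h, he]

end

/-! ### Hermite coefficients of the cosine and sine functions -/

section

variable {X : Type*} [NormedAddCommGroup X] [NormedSpace ℂ X] {C : ℝ → X →L[ℂ] X}

lemma integral_hermiteh_even (n : ℕ) (x : X) :
    ∫ t, hermiteh (2 * n) t • C t x =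
      (1 / (2 ^ (2 * n) * ((2 * n).factorial : ℝ) * √Real.pi)) • gaussCoeff C (2 * n) x := by
  rw [gaussCoeff, ← integral_smul]
  refine integral_congr_ae (.of_forall fun t => ?_)
  simp only [hermiteh_eq_gaussDeriv, smul_smul, pow_mul (-1 : ℝ), neg_one_sq, one_pow]

/-- Of the `2n` derivatives, `2p` are spent on `A^p`; the L¹ bound is applied to the remaining
`2(n-p)`. -/
lemma norm_gaussCoeff_opPow_le (hC : IsCosineFunction C) {M : ℝ} (hM : ∀ t, ‖C t‖ ≤ M) {p n : ℕ}
    (hpn : p ≤ n) (x : (opPow (generator C) p).domain) :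
    ‖gaussCoeff C (2 * n) (x : X)‖ ≤
      √Real.pi * (2 ^ n / 2 ^ p * √((2 * n - 2 * p).factorial : ℝ)) *
        (M * ‖opPow (generator C) p x‖) := by
  obtain ⟨k, rfl⟩ := Nat.exists_eq_add_of_le' hpn
  rw [show 2 * (k + p) = 2 * k + 2 * p by ring, gaussCoeff_opPow hC hM, Nat.add_sub_cancel]
  refine (norm_gaussCoeff_le hM _ _).trans_eq ?_
  rw [Real.sqrt_mul (by positivity), pow_mul', Real.sqrt_sq (by positivity), pow_add,
    mul_div_cancel_right₀ _ (by positivity)]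

lemma norm_sine_le {M : ℝ} (hM : ∀ t, ‖C t‖ ≤ M) (t : ℝ) (x : X) :
    ‖sine C t x‖ ≤ |t| * (M * ‖x‖) := by
  have := intervalIntegral.norm_integral_le_of_norm_le_const (a := 0) (b := t)
    (f := fun s => C s x) fun s _ => IsCosineFunction.norm_apply_le hM s x
  rw [sub_zero, mul_comm] at this
  exact this

lemma hasDerivAt_sine [CompleteSpace X] (hC : IsCosineFunction C) (t : ℝ) (x : X) :
    HasDerivAt (fun t => sine C t x) (C t x) t :=
  ((hC.strong_cont x).integral_hasStrictDerivAt 0 t).hasDerivAt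

lemma integrable_gaussDeriv_smul_sine [CompleteSpace X] (hC : IsCosineFunction C) {M : ℝ}
    (hM : ∀ t, ‖C t‖ ≤ M) (n : ℕ) (x : X) : Integrable fun t => gaussDeriv n t • sine C t x := by
  have hi := (integrable_eval_mul_gaussDeriv Polynomial.X n).norm.mul_const (M * ‖x‖)
  have hc : Continuous fun t => sine C t x :=
    continuous_iff_continuousAt.2 fun t => (hasDerivAt_sine hC t x).continuousAt
  refine hi.mono' ((continuous_gaussDeriv n).smul hc).aestronglyMeasurable (.of_forall fun t => ?_)
  rw [norm_smul, Polynomial.eval_X, norm_mul, mul_comm ‖t‖, mul_assoc]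
  exact mul_le_mul_of_nonneg_left (norm_sine_le hM t x) (norm_nonneg _)

/-- Integration by parts with `S' = C`: the sign it produces cancels the one in `h_{2n+1}`. The
linear growth of `S` is harmless against the Gaussian. -/
lemma integral_hermiteh_odd [CompleteSpace X] (hC : IsCosineFunction C) {M : ℝ}
    (hM : ∀ t, ‖C t‖ ≤ M) (n : ℕ) (x : X) :
    ∫ t, hermiteh (2 * n + 1) t • sine C t x =
      (1 / (2 ^ (2 * n + 1) * ((2 * n + 1).factorial : ℝ) * √Real.pi)) •
        gaussCoeff C (2 * n) x := by
  have h := integral_bilinear_hasDerivAt_right_eq_neg_left_of_integrable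
    (L := (ContinuousLinearMap.lsmul ℝ ℝ : ℝ →L[ℝ] X →L[ℝ] X))
    (u := gaussDeriv (2 * n)) (v := fun t => sine C t x) (v' := fun t => C t x)
    (fun t _ => hasDerivAt_gaussDeriv (2 * n) t) (fun t _ => hasDerivAt_sine hC t x)
    (integrable_gaussDeriv_smul hC hM (2 * n) x)
    (integrable_gaussDeriv_smul_sine hC hM (2 * n + 1) x)
    (integrable_gaussDeriv_smul_sine hC hM (2 * n) x)
  simp only [ContinuousLinearMap.lsmul_apply] at h
  rw [gaussCoeff, h, ← integral_neg, ← integral_smul]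
  refine integral_congr_ae (.of_forall fun t => ?_)
  simp only [hermiteh_eq_gaussDeriv, pow_succ (-1 : ℝ), pow_mul (-1 : ℝ)]
  module

/-! ### Decay of the terms and comparison of tails -/

lemma pow_mul_factorial_sub_le {p n : ℕ} (hpn : p ≤ n) :
    n ^ (2 * p) * (2 * n - 2 * p).factorial ≤ p ^ (2 * p) * (2 * n).factorial := by
  rcases Nat.eq_zero_or_pos p with rfl | hp
  · simp
  have h1 := Nat.factorial_mul_descFactorial (show 2 * p ≤ 2 * n by omega)
  have h2 := Nat.pow_sub_le_descFactorial (2 * n) (2 * p)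
  -- The `2p` factors of `(2n)!/(2n-2p)!` are all at least `2n+1-2p`, hence at least `n/p`, even
  -- when `p = n`. This is the source of `p^p` in the constants.
  have h3 : n ≤ p * (2 * n + 1 - 2 * p) := by
    obtain ⟨k, rfl⟩ := Nat.exists_eq_add_of_le hpn
    rw [show 2 * (p + k) + 1 - 2 * p = 2 * k + 1 by omega]
    nlinarith
  calc n ^ (2 * p) * (2 * n - 2 * p).factorial
      ≤ (p * (2 * n + 1 - 2 * p)) ^ (2 * p) * (2 * n - 2 * p).factorial := by gcongr
    _ = p ^ (2 * p) * ((2 * n - 2 * p).factorial * (2 * n + 1 - 2 * p) ^ (2 * p)) := by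
        rw [mul_pow]; ring
    _ ≤ p ^ (2 * p) * ((2 * n - 2 * p).factorial * (2 * n).descFactorial (2 * p)) := by gcongr
    _ = _ := by rw [h1]

lemma sqrt_factorial_sub_le {p n : ℕ} (hpn : p ≤ n) (hn : 1 ≤ n) :
    √((2 * n - 2 * p).factorial : ℝ) ≤ p ^ p / n ^ p * √((2 * n).factorial : ℝ) := by
  have h : (n : ℝ) ^ (2 * p) * (2 * n - 2 * p).factorial ≤ p ^ (2 * p) * (2 * n).factorial := by
    exact_mod_cast pow_mul_factorial_sub_le hpn
  have hn0 : (0 : ℝ) < n := by exact_mod_cast hn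
  have h2 := Real.sqrt_le_sqrt h
  rw [Real.sqrt_mul (by positivity), Real.sqrt_mul (by positivity), pow_mul', pow_mul' (p : ℝ),
    Real.sqrt_sq (by positivity), Real.sqrt_sq (by positivity)] at h2
  rw [div_mul_eq_mul_div, le_div_iff₀ (by positivity), mul_comm]
  exact h2

/-- A telescoping form of the integral comparison, obtained from `log u ≤ u - 1` and `1 + v ≤ e^v`.
-/
lemma mul_rpow_neg_add_one_le {q y : ℝ} (hq : 0 < q) (hy : 0 < y) :
    q * (y + 1) ^ (-(q + 1)) ≤ y ^ (-q) - (y + 1) ^ (-q) := by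
  have hy1 : 0 < y + 1 := by linarith
  have h1 : Real.log (y / (y + 1)) ≤ -(1 / (y + 1)) := by
    refine (Real.log_le_sub_one_of_pos (by positivity)).trans_eq ?_
    field_simp
    ring
  have h2 : 1 + q * (1 / (y + 1)) ≤ (y / (y + 1)) ^ (-q) := by
    rw [Real.rpow_def_of_pos (by positivity)]
    refine le_trans ?_ (Real.add_one_le_exp _)
    nlinarith
  have h3 : (y / (y + 1)) ^ (-q) = y ^ (-q) / (y + 1) ^ (-q) :=
    Real.div_rpow hy.le hy1.le _
  have h4 := Real.rpow_pos_of_pos hy1 (-q)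
  rw [h3, le_div_iff₀ h4] at h2
  rw [neg_add, Real.rpow_add hy1, Real.rpow_neg_one, ← one_div]
  linarith

lemma sum_rpow_tail_le {q : ℝ} (hq : 0 < q) {m : ℕ} (hm : 1 ≤ m) (N : ℕ) :
    ∑ k ∈ Finset.range N, ((k + (m + 1) : ℕ) : ℝ) ^ (-(q + 1)) ≤ (m : ℝ) ^ (-q) / q := by
  have key : ∑ k ∈ Finset.range N, q * ((k + (m + 1) : ℕ) : ℝ) ^ (-(q + 1)) ≤
      (m : ℝ) ^ (-q) - ((N + m : ℕ) : ℝ) ^ (-q) := by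
    induction N with
    | zero => simp
    | succ N ih =>
      rw [Finset.sum_range_succ]
      have hpos : (0 : ℝ) < ((N + m : ℕ) : ℝ) := by exact_mod_cast (by omega : 0 < N + m)
      have h := mul_rpow_neg_add_one_le hq hpos
      have e : ((N + m : ℕ) : ℝ) + 1 = ((N + (m + 1) : ℕ) : ℝ) := by push_cast; ring
      have e2 : N + 1 + m = N + (m + 1) := by ring
      rw [e] at h
      rw [e2]
      linarith
  rw [le_div_iff₀ hq, Finset.sum_mul]
  have h0 : 0 ≤ ((N + m : ℕ) : ℝ) ^ (-q) := Real.rpow_nonneg (Nat.cast_nonneg _) _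
  simp only [mul_comm _ q]
  linarith

lemma summable_rpow_tail {q : ℝ} (hq : 0 < q) {m : ℕ} (hm : 1 ≤ m) :
    Summable fun k : ℕ => ((k + (m + 1) : ℕ) : ℝ) ^ (-(q + 1)) :=
  summable_of_sum_range_le (fun _ => Real.rpow_nonneg (Nat.cast_nonneg _) _)
    (sum_rpow_tail_le hq hm)

/-- A series whose terms decay like `n^{-(q+1)}` has tails of order `m^{-q}`. -/
lemma norm_sub_partialSum_le {E : Type*} [NormedAddCommGroup E] {u : ℕ → E} {a : E}
    (hu : HasSum u a) {q K : ℝ} (hq : 0 < q) (hK : 0 ≤ K) {m : ℕ} (hm : 1 ≤ m)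
    (hle : ∀ n, m + 1 ≤ n → ‖u n‖ ≤ K * (n : ℝ) ^ (-(q + 1))) :
    ‖a - ∑ n ∈ Finset.range (m + 1), u n‖ ≤ K / q / (m : ℝ) ^ q := by
  have h1 := (hasSum_nat_add_iff' (m + 1)).2 hu
  have hs := summable_rpow_tail hq hm
  have h2 : ‖∑' k, u (k + (m + 1))‖ ≤ ∑' k : ℕ, K * ((k + (m + 1) : ℕ) : ℝ) ^ (-(q + 1)) :=
    tsum_of_norm_bounded (hs.mul_left K).hasSum fun k => hle _ (Nat.le_add_left _ _)
  rw [h1.tsum_eq, tsum_mul_left] at h2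
  refine h2.trans ?_
  have h3 : ∑' k : ℕ, ((k + (m + 1) : ℕ) : ℝ) ^ (-(q + 1)) ≤ (m : ℝ) ^ (-q) / q :=
    Real.tsum_le_of_sum_range_le (fun _ => Real.rpow_nonneg (Nat.cast_nonneg _) _)
      (sum_rpow_tail_le hq hm)
  refine (mul_le_mul_of_nonneg_left h3 hK).trans_eq ?_
  rw [Real.rpow_neg (Nat.cast_nonneg _)]
  field_simp

/-- The available exponent `-1/4` is weakened to `-1/12`: summing a tail costs one power, and `p +
1/12 - 1 = p - 11/12`, `p + 1/12 + 1/2 - 1 = p - 5/12`. -/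
lemma one_div_sqrt_sqrt_le {n : ℕ} (hn : 1 ≤ n) :
    1 / √(√(2 * n + 1)) ≤ (n : ℝ) ^ (-(1 / 12) : ℝ) := by
  have hn1 : (1 : ℝ) ≤ n := by exact_mod_cast hn
  rw [Real.rpow_neg (by positivity), ← one_div]
  refine one_div_le_one_div_of_le (by positivity) ?_
  rw [Real.sqrt_eq_rpow, Real.sqrt_eq_rpow, ← Real.rpow_mul (by positivity)]
  calc (n : ℝ) ^ (1 / 12 : ℝ) ≤ (n : ℝ) ^ (1 / 2 * (1 / 2) : ℝ) :=
        Real.rpow_le_rpow_of_exponent_le hn1 (by norm_num)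
    _ ≤ _ := Real.rpow_le_rpow (by positivity) (by linarith) (by norm_num)

/-- Here `y` stands for the norm of `A^n T(1/4) x`, and the denominator is what the Hermite factor
contributes apart from `e^{t^2}`. -/
lemma coefficient_decay {p n : ℕ} (hpn : p ≤ n) (hn : 1 ≤ n) {y B : ℝ} (hB : 0 ≤ B)
    (hy : y ≤ 2 ^ n * √((2 * n - 2 * p).factorial : ℝ) * B) :
    y / (2 ^ (2 * n) * n.factorial) ≤ p ^ p * B * (n : ℝ) ^ (-((p : ℝ) + 1 / 12)) := by
  have hn0 : (0 : ℝ) < n := by exact_mod_cast hn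
  have hf : (0 : ℝ) < n.factorial := by exact_mod_cast Nat.factorial_pos _
  calc y / (2 ^ (2 * n) * n.factorial)
      ≤ (2 ^ n * (p ^ p / n ^ p * √((2 * n).factorial : ℝ)) * B) / (2 ^ (2 * n) * n.factorial) := by
        have := sqrt_factorial_sub_le hpn hn
        refine div_le_div_of_nonneg_right (hy.trans ?_) (by positivity)
        gcongr
    _ = p ^ p * B * (1 / n ^ p * (√((2 * n).factorial : ℝ) / (2 ^ n * n.factorial))) := by
        rw [pow_mul']
        field_simp
    _ ≤ p ^ p * B * (1 / n ^ p * (n : ℝ) ^ (-(1 / 12) : ℝ)) := by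
        have := (sqrt_factorial_div_le n).trans (one_div_sqrt_sqrt_le hn)
        gcongr
    _ = _ := by
        rw [neg_add, Real.rpow_add hn0, Real.rpow_neg hn0.le (p : ℝ),
          Real.rpow_natCast, one_div]

lemma abs_hermiteH_even_div_le (n : ℕ) (t : ℝ) :
    |hermiteH (2 * n) t / (2 ^ (2 * n) * ((2 * n).factorial : ℝ))| ≤
      Real.exp (t ^ 2) / (2 ^ (2 * n) * n.factorial) := by
  have hf : (0 : ℝ) < n.factorial := by exact_mod_cast Nat.factorial_pos _
  have hf2 : (0 : ℝ) < (2 * n).factorial := by exact_mod_cast Nat.factorial_pos _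
  rw [abs_div, abs_of_pos (by positivity : 0 < (2 : ℝ) ^ (2 * n) * ((2 * n).factorial : ℝ)),
    div_le_iff₀ (by positivity)]
  refine (abs_hermiteH_even_le n t).trans_eq ?_
  field_simp

lemma abs_hermiteH_odd_div_le {n : ℕ} (hn : 1 ≤ n) (t : ℝ) :
    |hermiteH (2 * n + 1) t / (2 ^ (2 * n + 1) * ((2 * n + 1).factorial : ℝ))| ≤
      Real.exp (t ^ 2) / (2 ^ (2 * n) * n.factorial) * (n : ℝ) ^ (-(1 / 2) : ℝ) := by
  have hn0 : (0 : ℝ) < n := by exact_mod_cast hn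
  have hf : (0 : ℝ) < n.factorial := by exact_mod_cast Nat.factorial_pos _
  have hf2 : (0 : ℝ) < (2 * n).factorial := by exact_mod_cast Nat.factorial_pos _
  have hs : √(2 * (2 * (n : ℝ) + 1)) / (2 * (2 * n + 1)) ≤ (n : ℝ) ^ (-(1 / 2) : ℝ) := by
    rw [Real.rpow_neg hn0.le, ← Real.sqrt_eq_rpow, Real.sqrt_div_self', one_div]
    exact inv_anti₀ (Real.sqrt_pos.2 hn0) (Real.sqrt_le_sqrt (by linarith))
  rw [abs_div, abs_of_pos (by positivity : 0 < (2 : ℝ) ^ (2 * n + 1) * ((2 * n + 1).factorial : ℝ))]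
  calc |hermiteH (2 * n + 1) t| / (2 ^ (2 * n + 1) * ((2 * n + 1).factorial : ℝ))
      ≤ Real.exp (t ^ 2) * (√(2 * (2 * n + 1)) * ((2 * n).factorial / n.factorial)) /
          (2 ^ (2 * n + 1) * ((2 * n + 1).factorial : ℝ)) := by
        have := abs_hermiteH_odd_le n t
        gcongr
    _ = Real.exp (t ^ 2) / (2 ^ (2 * n) * n.factorial) *
          (√(2 * (2 * (n : ℝ) + 1)) / (2 * (2 * n + 1))) := by
        rw [Nat.factorial_succ, pow_succ]
        push_cast
        field_simp
        ring
    _ ≤ _ := by gcongr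

end

/-! ### Convergence of the cosine and sine series with rates -/

section

variable {X : Type*} [NormedAddCommGroup X] [NormedSpace ℂ X] {C : ℝ → X →L[ℂ] X}
  {x : X}

lemma norm_powApply_le [CompleteSpace X] (hC : IsCosineFunction C) {M : ℝ} (hM : ∀ t, ‖C t‖ ≤ M)
    {p n : ℕ} (hpn : p ≤ n) (x : (opPow (generator C) p).domain) :
    ‖powApply (generator C) n (semigroup C (1 / 4) (x : X))‖ ≤
      2 ^ n * √((2 * n - 2 * p).factorial : ℝ) * (M * ‖opPow (generator C) p x‖) := by
  have hM0 : 0 ≤ M := (norm_nonneg _).trans (hM 0)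
  have hpi := Real.sqrt_pos.2 Real.pi_pos
  rw [powApply_semigroup hC hM, norm_smul, Real.norm_eq_abs, abs_of_pos (inv_pos.2 hpi)]
  refine (mul_le_mul_of_nonneg_left (norm_gaussCoeff_opPow_le hC hM hpn x)
    (inv_pos.2 hpi).le).trans ?_
  rw [← mul_assoc, ← mul_assoc (√Real.pi)⁻¹, inv_mul_cancel₀ hpi.ne', one_mul]
  have h2 : (2 : ℝ) ^ n / 2 ^ p ≤ 2 ^ n := div_le_self (by positivity) (one_le_pow₀ one_le_two)
  gcongr

/-- The same estimate, with one more power of the generator and the weaker factorial. -/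
lemma norm_powApply_le_succ [CompleteSpace X] (hC : IsCosineFunction C) {M : ℝ}
    (hM : ∀ t, ‖C t‖ ≤ M) {p n : ℕ} (hpn : p + 1 ≤ n)
    (x : (opPow (generator C) (p + 1)).domain) :
    ‖powApply (generator C) n (semigroup C (1 / 4) (x : X))‖ ≤
      2 ^ n * √((2 * n - 2 * p).factorial : ℝ) * (M * ‖opPow (generator C) (p + 1) x‖) := by
  have hM0 : 0 ≤ M := (norm_nonneg _).trans (hM 0)
  refine (norm_powApply_le hC hM hpn x).trans ?_
  have h : ((2 * n - 2 * (p + 1)).factorial : ℝ) ≤ (2 * n - 2 * p).factorial := by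
    exact_mod_cast Nat.factorial_le (by omega)
  gcongr

lemma summable_of_coefficient_bound {E : Type*} [NormedAddCommGroup E] {p m : ℕ} {B : ℝ}
    (hp : 1 ≤ p) (hm : 1 ≤ m) (hpm : p ≤ m + 1) (hB : 0 ≤ B)
    {y : ℕ → E} (hy : ∀ n, m + 1 ≤ n → ‖y n‖ ≤ 2 ^ n * √((2 * n - 2 * p).factorial : ℝ) * B) :
    Summable fun n => ‖y n‖ / (2 ^ (2 * n) * (n.factorial : ℝ)) := by
  rw [← summable_nat_add_iff (m + 1)]
  have hp1 : (1 : ℝ) ≤ p := by exact_mod_cast hp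
  have hq : (0 : ℝ) < (p : ℝ) - 11 / 12 := by linarith
  refine Summable.of_nonneg_of_le (fun n => by positivity) (fun n => ?_)
    ((summable_rpow_tail hq hm).mul_left (p ^ p * B))
  have := coefficient_decay (p := p) (n := n + (m + 1)) (by omega) (by omega) hB
    (hy _ (Nat.le_add_left _ _))
  rwa [show -((p : ℝ) + 1 / 12) = -((p : ℝ) - 11 / 12 + 1) by ring] at this

/-- The summability hypothesis is free of `t`, which enters only through `e^{t^2}`; the series can
therefore be integrated in `t`. -/
lemma hasSum_cosine_series [CompleteSpace X] (hC : IsCosineFunction C) {M : ℝ}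
    (hM : ∀ t, ‖C t‖ ≤ M)
    (hs : Summable fun n => ‖powApply (generator C) n (semigroup C (1 / 4) x)‖ /
      (2 ^ (2 * n) * (n.factorial : ℝ))) (t : ℝ) :
    HasSum (fun n => (hermiteH (2 * n) t / (2 ^ (2 * n) * ((2 * n).factorial : ℝ))) •
      powApply (generator C) n (semigroup C (1 / 4) x)) (C t x) := by
  have e : ∀ n, (hermiteH (2 * n) t / (2 ^ (2 * n) * ((2 * n).factorial : ℝ))) •
      powApply (generator C) n (semigroup C (1 / 4) x) =
      hermiteH (2 * n) t • ∫ s, hermiteh (2 * n) s • C s x := by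
    intro n
    rw [powApply_semigroup hC hM, integral_hermiteh_even, smul_smul, smul_smul]
    congr 1
    rw [mul_one_div, ← div_eq_mul_inv, div_div]
  simp only [e]
  refine hasSum_hermite_series (hC.strong_cont x) (fun s => IsCosineFunction.norm_apply_le hM s x)
    (fun s => by rw [hC.map_neg]) t ?_
  refine Summable.of_nonneg_of_le (fun n => norm_nonneg _) (fun n => ?_)
    (hs.mul_left (Real.exp (t ^ 2)))
  rw [← e, norm_smul, Real.norm_eq_abs]
  refine (mul_le_mul_of_nonneg_right (abs_hermiteH_even_div_le n t) (norm_nonneg _)).trans_eq ?_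
  ring

lemma integral_hermiteH_even (n : ℕ) (t : ℝ) :
    ∫ s in (0 : ℝ)..t, hermiteH (2 * n) s / (2 ^ (2 * n) * ((2 * n).factorial : ℝ)) =
      hermiteH (2 * n + 1) t / (2 ^ (2 * n + 1) * ((2 * n + 1).factorial : ℝ)) := by
  have h := intervalIntegral.integral_eq_sub_of_hasDerivAt (a := 0) (b := t)
    (f := fun s => hermiteH (2 * n + 1) s / (2 ^ (2 * n + 1) * ((2 * n + 1).factorial : ℝ)))
    (f' := fun s => hermiteH (2 * n) s / (2 ^ (2 * n) * ((2 * n).factorial : ℝ)))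
    (fun s _ => by
      convert! (hasDerivAt_hermiteH_succ (2 * n) s).div_const
        (2 ^ (2 * n + 1) * ((2 * n + 1).factorial : ℝ)) using 1
      rw [Nat.factorial_succ, pow_succ]
      have := Nat.factorial_pos (2 * n)
      push_cast
      field_simp)
    (((continuous_hermiteH (2 * n)).div_const _).intervalIntegrable _ _)
  rw [h, hermiteH_odd_zero, zero_div, sub_zero]

/-- Termwise integration of the cosine series over `[0, t]`; no constants appear because
`H_{2n+1}(0) = 0`. -/
lemma hasSum_sine_series [CompleteSpace X] (hC : IsCosineFunction C) {M : ℝ}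
    (hM : ∀ t, ‖C t‖ ≤ M)
    (hs : Summable fun n => ‖powApply (generator C) n (semigroup C (1 / 4) x)‖ /
      (2 ^ (2 * n) * (n.factorial : ℝ))) (t : ℝ) :
    HasSum (fun n => (hermiteH (2 * n + 1) t / (2 ^ (2 * n + 1) * ((2 * n + 1).factorial : ℝ))) •
      powApply (generator C) n (semigroup C (1 / 4) x)) (sine C t x) := by
  have h := intervalIntegral.hasSum_integral_of_dominated_convergence (μ := volume)
    (a := 0) (b := t)
    (F := fun n s => (hermiteH (2 * n) s / (2 ^ (2 * n) * ((2 * n).factorial : ℝ))) •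
      powApply (generator C) n (semigroup C (1 / 4) x)) (f := fun s => C s x)
    (fun n s => Real.exp (s ^ 2) * (‖powApply (generator C) n (semigroup C (1 / 4) x)‖ /
      (2 ^ (2 * n) * (n.factorial : ℝ))))
    (fun n => (((continuous_hermiteH (2 * n)).div_const _).smul
      continuous_const).aestronglyMeasurable)
    (fun n => .of_forall fun s _ => by
      rw [norm_smul, Real.norm_eq_abs]
      refine (mul_le_mul_of_nonneg_right (abs_hermiteH_even_div_le n s) (norm_nonneg _)).trans_eq ?_
      ring)
    (.of_forall fun s _ => hs.mul_left _)
    (by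
      simp only [tsum_mul_left]
      exact Continuous.intervalIntegrable (by fun_prop) _ _)
    (.of_forall fun s _ => hasSum_cosine_series hC hM hs s)
  simp only [intervalIntegral.integral_smul_const, integral_hermiteH_even] at h
  exact h

lemma norm_sub_cosPartial_le [CompleteSpace X] (hC : IsCosineFunction C) {M : ℝ} (hM : ∀ t, ‖C t‖ ≤ M)
    {p m : ℕ} {B : ℝ} (hp : 1 ≤ p) (hm : 1 ≤ m) (hpm : p ≤ m + 1) (hB : 0 ≤ B)
    (hy : ∀ n, m + 1 ≤ n → ‖powApply (generator C) n (semigroup C (1 / 4) x)‖ ≤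
      2 ^ n * √((2 * n - 2 * p).factorial : ℝ) * B) (t : ℝ) :
    ‖C t x - cosPartial C m t x‖ ≤
      12 * Real.exp (t ^ 2) * p ^ p * B / (m : ℝ) ^ ((p : ℝ) - 11 / 12) := by
  have hp1 : (1 : ℝ) ≤ p := by exact_mod_cast hp
  have hq : (0 : ℝ) < (p : ℝ) - 11 / 12 := by linarith
  have hs := summable_of_coefficient_bound hp hm hpm hB hy
  have hK : 0 ≤ Real.exp (t ^ 2) * p ^ p * B := by positivity
  refine (norm_sub_partialSum_le (hasSum_cosine_series hC hM hs t) hq hK hm fun n hn => ?_).trans ?_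
  · rw [norm_smul, Real.norm_eq_abs]
    have h1 := coefficient_decay (p := p) (by omega) (by omega) hB (hy n hn)
    rw [show -((p : ℝ) + 1 / 12) = -((p : ℝ) - 11 / 12 + 1) by ring] at h1
    refine (mul_le_mul_of_nonneg_right (abs_hermiteH_even_div_le n t) (norm_nonneg _)).trans ?_
    have h2 := mul_le_mul_of_nonneg_left h1 (Real.exp_pos (t ^ 2)).le
    refine le_trans (le_of_eq ?_) (h2.trans_eq ?_) <;> ring
  · refine div_le_div_of_nonneg_right ?_ (Real.rpow_nonneg (Nat.cast_nonneg _) _)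
    -- The tail sum contributes `1/q`, and `q = p - 11/12 ≥ 1/12` accounts for the `12`.
    rw [div_le_iff₀ hq]
    nlinarith

/-- Leaving `B` free lets the same estimate serve for `A^p x` and for `A^{p+1} x`. -/
lemma norm_sub_sinPartial_le [CompleteSpace X] (hC : IsCosineFunction C) {M : ℝ} (hM : ∀ t, ‖C t‖ ≤ M)
    {p m : ℕ} {B : ℝ} (hp : 1 ≤ p) (hm : 1 ≤ m) (hpm : p ≤ m + 1) (hB : 0 ≤ B)
    (hy : ∀ n, m + 1 ≤ n → ‖powApply (generator C) n (semigroup C (1 / 4) x)‖ ≤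
      2 ^ n * √((2 * n - 2 * p).factorial : ℝ) * B) (t : ℝ) :
    ‖sine C t x - sinPartial C m t x‖ ≤
      12 * Real.exp (t ^ 2) * p ^ p * B / (m : ℝ) ^ ((p : ℝ) - 5 / 12) := by
  have hp1 : (1 : ℝ) ≤ p := by exact_mod_cast hp
  have hq : (0 : ℝ) < (p : ℝ) - 5 / 12 := by linarith
  have hs := summable_of_coefficient_bound hp hm hpm hB hy
  have hK : 0 ≤ Real.exp (t ^ 2) * p ^ p * B := by positivity
  refine (norm_sub_partialSum_le (hasSum_sine_series hC hM hs t) hq hK hm fun n hn => ?_).trans ?_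
  · rw [norm_smul, Real.norm_eq_abs]
    have hn0 : (0 : ℝ) < n := by exact_mod_cast (by omega : 0 < n)
    have h1 := coefficient_decay (p := p) (by omega) (by omega) hB (hy n hn)
    refine (mul_le_mul_of_nonneg_right (abs_hermiteH_odd_div_le (by omega) t)
      (norm_nonneg _)).trans ?_
    have h2 := mul_le_mul_of_nonneg_left h1
      (by positivity : 0 ≤ Real.exp (t ^ 2) * (n : ℝ) ^ (-(1 / 2) : ℝ))
    rw [show -((p : ℝ) - 5 / 12 + 1) = -((p : ℝ) + 1 / 12) + -(1 / 2) by ring, Real.rpow_add hn0]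
    refine le_trans (le_of_eq ?_) (h2.trans_eq ?_) <;> ring
  · refine div_le_div_of_nonneg_right ?_ (Real.rpow_nonneg (Nat.cast_nonneg _) _)
    rw [div_le_iff₀ hq]
    nlinarith

/-! ### The Fejér family -/

lemma integrable_of_abs_le_inv_one_add_sq [CompleteSpace X] (hC : IsCosineFunction C) {M : ℝ}
    (hM : ∀ t, ‖C t‖ ≤ M) {g : ℝ → ℝ} (hg : Measurable g) {K : ℝ}
    (hle : ∀ s, 0 < s → |g s| ≤ K * (1 + s ^ 2)⁻¹) (x : X) :
    IntegrableOn (fun s => g s • C s x) (Set.Ioi 0) := by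
  have hi : IntegrableOn g (Set.Ioi 0) := by
    refine ((integrable_inv_one_add_sq.const_mul K).integrableOn).mono'
      hg.aestronglyMeasurable ?_
    exact (ae_restrict_iff' measurableSet_Ioi).2 (.of_forall fun s hs => hle s hs)
  refine (hi.norm.mul_const (M * ‖x‖)).mono'
    (hi.1.smul (hC.strong_cont x).aestronglyMeasurable) (.of_forall fun s => ?_)
  rw [norm_smul]
  exact mul_le_mul_of_nonneg_left (IsCosineFunction.norm_apply_le hM s x) (norm_nonneg _)

/-- The bound `2` controls large `s`, the bound `b s^2` the singularity at `0`. -/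
lemma abs_div_pi_sq_le {a b s : ℝ} (hs : 0 < s) (ha : 0 ≤ a) (h1 : a ≤ 2)
    (h2 : a ≤ b * s ^ 2) : |a / (Real.pi * s ^ 2)| ≤ (2 + b) * (1 + s ^ 2)⁻¹ := by
  rw [abs_of_nonneg (by positivity), ← div_eq_mul_inv, div_le_div_iff₀ (by positivity)
    (by positivity)]
  have hpi := Real.pi_gt_three
  have hb : 0 ≤ (2 + b) * s ^ 2 := by nlinarith [sq_nonneg s]
  nlinarith

lemma integrableOn_fejerKernel_smul [CompleteSpace X] (hC : IsCosineFunction C) {M : ℝ}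
    (hM : ∀ t, ‖C t‖ ≤ M) (t : ℝ) (x : X) :
    IntegrableOn (fun s => fejerKernel t s • C s x) (Set.Ioi 0) := by
  refine integrable_of_abs_le_inv_one_add_sq hC hM (K := 2 + t ^ 2 / 2)
    (by unfold fejerKernel; fun_prop) (fun s hs => ?_) x
  refine abs_div_pi_sq_le hs ?_ ?_ ?_
  · linarith [Real.cos_le_one (t * s)]
  · linarith [Real.neg_one_le_cos (t * s)]
  · have := Real.one_sub_sq_div_two_le_cos (x := t * s)
    nlinarith

lemma integrableOn_heat_smul [CompleteSpace X] (hC : IsCosineFunction C) {M : ℝ}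
    (hM : ∀ t, ‖C t‖ ≤ M) (x : X) :
    IntegrableOn (fun s : ℝ => ((1 - Real.exp (-s ^ 2 / 4)) / (Real.pi * s ^ 2)) • C s x)
      (Set.Ioi 0) := by
  refine integrable_of_abs_le_inv_one_add_sq hC hM (K := 2 + 1 / 4) (by fun_prop)
    (fun s hs => ?_) x
  have h := Real.add_one_le_exp (-s ^ 2 / 4)
  have h1 : Real.exp (-s ^ 2 / 4) ≤ 1 := Real.exp_le_one_iff.2 (by nlinarith [sq_nonneg s])
  have h2 := Real.exp_pos (-s ^ 2 / 4)
  exact abs_div_pi_sq_le hs (by linarith) (by linarith) (by linarith)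

/-- The coefficients of the Hermite expansion of the Fejér kernel. -/
def fejerCoeff (n : ℕ) (s : ℝ) : ℝ :=
  (-1) ^ n * s ^ (2 * n) * Real.exp (-s ^ 2 / 4) /
    (2 ^ (2 * (n + 1)) * ((2 * (n + 1)).factorial : ℝ) * Real.pi)

lemma fejerCoeff_eq (n : ℕ) (s : ℝ) :
    fejerCoeff n s = (-1) ^ n / (2 ^ (2 * (n + 1)) * ((2 * (n + 1)).factorial : ℝ) * Real.pi) *
      (s ^ (2 * n) * Real.exp (-(1 / 4) * s ^ 2)) := by
  rw [fejerCoeff, show -s ^ 2 / 4 = -(1 / 4) * s ^ 2 by ring]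
  ring

lemma integrableOn_fejerCoeff (n : ℕ) : IntegrableOn (fejerCoeff n) (Set.Ioi 0) := by
  rw [show fejerCoeff n = _ from funext (fejerCoeff_eq n)]
  exact (integrableOn_even_moment n (by norm_num : (0 : ℝ) < 1 / 4)).const_mul _

lemma integral_abs_fejerCoeff (n : ℕ) :
    ∫ s in Set.Ioi (0 : ℝ), |fejerCoeff n s| =
      (2 * n).factorial / (n.factorial * 2 ^ (2 * (n + 1)) * (2 * (n + 1)).factorial *
        √Real.pi) := by
  have e : ∀ s, |fejerCoeff n s| = 1 / (2 ^ (2 * (n + 1)) * ((2 * (n + 1)).factorial : ℝ) *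
      Real.pi) * (s ^ (2 * n) * Real.exp (-(1 / 4) * s ^ 2)) := by
    intro s
    have h1 : 0 ≤ s ^ (2 * n) * Real.exp (-(1 / 4) * s ^ 2) := by rw [pow_mul]; positivity
    have h2 : 0 < 2 ^ (2 * (n + 1)) * ((2 * (n + 1)).factorial : ℝ) * Real.pi := by
      have := Real.pi_pos
      positivity
    rw [fejerCoeff_eq, abs_mul, abs_of_nonneg h1, abs_div, abs_of_pos h2, abs_pow, abs_neg, abs_one,
      one_pow]
  simp only [e]
  rw [integral_const_mul, integral_Ioi_even_moment n (by norm_num : (0 : ℝ) < 1 / 4)]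
  have h4 : √(Real.pi / (1 / 4)) = √Real.pi * 2 := by
    rw [show Real.pi / (1 / 4) = Real.pi * 2 ^ 2 by ring, Real.sqrt_mul Real.pi_pos.le,
      Real.sqrt_sq two_pos.le]
  have h5 : (4 : ℝ) ^ n * (1 / 4) ^ n = 1 := by rw [← mul_pow]; norm_num
  have hf := Nat.factorial_pos n
  have hf2 := Nat.factorial_pos (2 * (n + 1))
  have hpi := Real.pi_pos
  have hsq := Real.sq_sqrt hpi.le
  have hs := Real.sqrt_pos.2 hpi
  rw [h4, mul_right_comm (4 ^ n : ℝ), h5, one_mul]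
  rw [div_mul_div_comm, div_mul_div_comm, div_eq_div_iff (by positivity) (by positivity)]
  linear_combination (2 * ((2 * n).factorial : ℝ) * n.factorial * 2 ^ (2 * (n + 1)) *
    (2 * (n + 1)).factorial) * hsq

/-- The generating function at `v = s/2`, with its term of index `0` removed, times `-2
e^{-s^2/4}/(π s^2)`. The removed term accounts for the subtracted heat kernel part. -/
lemma hasSum_fejerCoeff (t : ℝ) {s : ℝ} (hs : 0 < s) :
    HasSum (fun n => 2 * hermiteH (2 * (n + 1)) t * fejerCoeff n s)
      (2 * fejerKernel t s - 2 * ((1 - Real.exp (-s ^ 2 / 4)) / (Real.pi * s ^ 2))) := by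
  have h := (hasSum_nat_add_iff' 1).2 (hasSum_hermiteH_even t (s / 2))
  have h1 := h.mul_left (-(2 * Real.exp (-s ^ 2 / 4) / (Real.pi * s ^ 2)))
  have hpi := Real.pi_pos
  convert! h1 using 1
  · ext n
    have hf := Nat.factorial_pos (2 * (n + 1))
    rw [fejerCoeff, div_pow, pow_succ (-1 : ℝ), mul_add 2 n 1, pow_add s]
    field_simp
  · have e : Real.exp (-s ^ 2 / 4) * Real.exp ((s / 2) ^ 2) = 1 := by
      rw [← Real.exp_add, ← Real.exp_zero]
      congr 1
      ring
    rw [Finset.sum_range_one, show 2 * t * (s / 2) = t * s by ring, fejerKernel, mul_zero,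
      hermiteH_zero]
    simp only [pow_zero, Nat.factorial_zero, Nat.cast_one]
    generalize Real.exp (-s ^ 2 / 4) = a at e ⊢
    generalize Real.exp ((s / 2) ^ 2) = b at e ⊢
    field_simp
    linear_combination Real.cos (t * s) * e

lemma hasSum_fejerFamily [CompleteSpace X] (hC : IsCosineFunction C) {M : ℝ}
    (hM : ∀ t, ‖C t‖ ≤ M) (x : X) (t : ℝ) :
    HasSum (fun n => (2 * hermiteH (2 * (n + 1)) t) •
      ∫ s in Set.Ioi (0 : ℝ), fejerCoeff n s • C s x)
      (fejerFamily C t x - (2 : ℝ) • ∫ s in Set.Ioi (0 : ℝ),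
        ((1 - Real.exp (-s ^ 2 / 4)) / (Real.pi * s ^ 2)) • C s x) := by
  have hM0 : 0 ≤ M := (norm_nonneg _).trans (hM 0)
  have hint : ∀ n, IntegrableOn (fun s => (2 * hermiteH (2 * (n + 1)) t * fejerCoeff n s) • C s x)
      (Set.Ioi 0) := by
    intro n
    have hi := (integrableOn_fejerCoeff n).const_mul (2 * hermiteH (2 * (n + 1)) t)
    refine (hi.norm.mul_const (M * ‖x‖)).mono'
      (hi.1.smul (hC.strong_cont x).aestronglyMeasurable) (.of_forall fun s => ?_)
    rw [norm_smul]
    exact mul_le_mul_of_nonneg_left (IsCosineFunction.norm_apply_le hM s x) (norm_nonneg _)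
  -- The shift from `n` to `n + 1` in the factorials gives one power of `1/(n+1)`, the central
  -- binomial ratio another half power; `3/2 > 1` suffices.
  have hbd : ∀ n : ℕ, ∫ s in Set.Ioi (0 : ℝ),
      ‖(2 * hermiteH (2 * (n + 1)) t * fejerCoeff n s) • C s x‖ ≤
      (2 * Real.exp (t ^ 2) * (M * ‖x‖)) * (1 / ((n + 1 : ℕ) : ℝ) ^ (3 / 2 : ℝ)) := by
    intro n
    have hn1 : (0 : ℝ) < n + 1 := by positivity
    have hf := Nat.factorial_pos n
    have hf1 := Nat.factorial_pos (n + 1)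
    have hf2 := Nat.factorial_pos (2 * (n + 1))
    have hpi : 1 ≤ √Real.pi := by
      rw [Real.one_le_sqrt]
      linarith [Real.pi_gt_three]
    calc ∫ s in Set.Ioi (0 : ℝ), ‖(2 * hermiteH (2 * (n + 1)) t * fejerCoeff n s) • C s x‖
        ≤ ∫ s in Set.Ioi (0 : ℝ), (2 * |hermiteH (2 * (n + 1)) t| * (M * ‖x‖)) *
            |fejerCoeff n s| := by
          refine integral_mono (hint n).norm ((integrableOn_fejerCoeff n).abs.const_mul _)
            fun s => ?_
          simp only [norm_smul, Real.norm_eq_abs, abs_mul, abs_two]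
          have := IsCosineFunction.norm_apply_le hM s x
          refine (mul_le_mul_of_nonneg_left this (by positivity)).trans_eq ?_
          ring
      _ ≤ (2 * (Real.exp (t ^ 2) * ((2 * (n + 1)).factorial / (n + 1).factorial)) * (M * ‖x‖)) *
            ((2 * n).factorial / (n.factorial * 2 ^ (2 * (n + 1)) * (2 * (n + 1)).factorial *
              √Real.pi)) := by
          rw [integral_const_mul, integral_abs_fejerCoeff]
          have := abs_hermiteH_even_le (n + 1) t
          gcongr
      _ = (2 * Real.exp (t ^ 2) * (M * ‖x‖)) * (((2 * n).factorial / (4 ^ n * n.factorial ^ 2)) *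
            (1 / (4 * √Real.pi * (n + 1)))) := by
          rw [Nat.factorial_succ n, pow_mul, pow_succ]
          push_cast
          field_simp
          norm_num
          ring
      _ ≤ (2 * Real.exp (t ^ 2) * (M * ‖x‖)) * (1 / √(2 * n + 1) * (1 / (1 * (n + 1)))) := by
          have := factorial_ratio_le n
          have h4 : 1 ≤ 4 * √Real.pi := by linarith
          gcongr
      _ ≤ _ := by
          refine mul_le_mul_of_nonneg_left ?_ (by positivity)
          have h1 : √((n : ℝ) + 1) ≤ √(2 * n + 1) :=
            Real.sqrt_le_sqrt (by linarith [(Nat.cast_nonneg n : (0 : ℝ) ≤ n)])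
          have h0 := Real.sqrt_pos.2 hn1
          rw [one_mul, one_div_mul_one_div]
          refine one_div_le_one_div_of_le (by positivity) ?_
          push_cast
          rw [show (3 / 2 : ℝ) = 1 / 2 + 1 by norm_num, Real.rpow_add hn1, Real.rpow_one,
            ← Real.sqrt_eq_rpow]
          gcongr
  have hsum : Summable fun n => ∫ s in Set.Ioi (0 : ℝ),
      ‖(2 * hermiteH (2 * (n + 1)) t * fejerCoeff n s) • C s x‖ :=
    Summable.of_nonneg_of_le (fun n => integral_nonneg fun s => norm_nonneg _) hbd
      (((summable_nat_add_iff 1).2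
        (Real.summable_one_div_nat_rpow.2 (by norm_num : (1 : ℝ) < 3 / 2))).mul_left _)
  have h := hasSum_integral_of_summable_integral_norm hint hsum
  have e : ∫ s in Set.Ioi (0 : ℝ),
      ∑' n, (2 * hermiteH (2 * (n + 1)) t * fejerCoeff n s) • C s x =
      fejerFamily C t x - (2 : ℝ) • ∫ s in Set.Ioi (0 : ℝ),
        ((1 - Real.exp (-s ^ 2 / 4)) / (Real.pi * s ^ 2)) • C s x := by
    rw [fejerFamily, ← smul_sub, ← integral_sub (integrableOn_fejerKernel_smul hC hM t x)
      (integrableOn_heat_smul hC hM x), ← integral_smul]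
    refine setIntegral_congr_fun measurableSet_Ioi fun s hs => ?_
    refine ((hasSum_fejerCoeff t hs).smul_const (C s x)).tsum_eq.trans ?_
    module
  rw [e] at h
  simp only [mul_smul _ (fejerCoeff _ _), integral_smul] at h
  exact h

lemma integrableOn_fejerCoeff_smul [CompleteSpace X] (hC : IsCosineFunction C) {M : ℝ}
    (hM : ∀ t, ‖C t‖ ≤ M) (n : ℕ) (x : X) :
    IntegrableOn (fun s => fejerCoeff n s • C s x) (Set.Ioi 0) := by
  have hi := integrableOn_fejerCoeff n
  refine (hi.norm.mul_const (M * ‖x‖)).mono'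
    (hi.1.smul (hC.strong_cont x).aestronglyMeasurable) (.of_forall fun s => ?_)
  rw [norm_smul]
  exact mul_le_mul_of_nonneg_left (IsCosineFunction.norm_apply_le hM s x) (norm_nonneg _)

end

/-! ### Assembling the estimates -/

section

variable {X : Type*} [NormedAddCommGroup X] [NormedSpace ℂ X] {C : ℝ → X →L[ℂ] X}

/-- A bound of at least `1` makes the constants strictly positive, also when `X` is trivial. -/
lemma exists_one_le_bound (h : ∃ M : ℝ, ∀ t : ℝ, ‖C t‖ ≤ M) :
    ∃ M : ℝ, 1 ≤ M ∧ ∀ t : ℝ, ‖C t‖ ≤ M := by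
  obtain ⟨M, hM⟩ := h
  exact ⟨max 1 M, le_max_left _ _, fun t => (hM t).trans (le_max_right _ _)⟩

lemma integrable_hermiteh_smul_sine [CompleteSpace X] (hC : IsCosineFunction C) {M : ℝ}
    (hM : ∀ t, ‖C t‖ ≤ M) (n : ℕ) (x : X) : Integrable fun t => hermiteh n t • sine C t x := by
  simp only [hermiteh_eq_gaussDeriv, mul_smul]
  exact (integrable_gaussDeriv_smul_sine hC hM n x).smul _

lemma norm_integral_hermiteh_even_le (hC : IsCosineFunction C) {M : ℝ} (hM : ∀ t, ‖C t‖ ≤ M)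
    {p n : ℕ} (hpn : p ≤ n) (x : (opPow (generator C) p).domain) :
    ‖∫ t : ℝ, hermiteh (2 * n) t • C t (x : X)‖ ≤
      M * √((2 * n - 2 * p).factorial : ℝ) / (2 ^ (n + p) * ((2 * n).factorial : ℝ)) *
        ‖opPow (generator C) p x‖ := by
  have hpi := Real.sqrt_pos.2 Real.pi_pos
  have hf : (0 : ℝ) < (2 * n).factorial := by exact_mod_cast Nat.factorial_pos _
  rw [integral_hermiteh_even, norm_smul, Real.norm_eq_abs, abs_of_pos (by positivity)]
  refine (mul_le_mul_of_nonneg_left (norm_gaussCoeff_opPow_le hC hM hpn x)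
    (by positivity)).trans_eq ?_
  rw [pow_mul', pow_add]
  field_simp

lemma norm_integral_hermiteh_odd_le [CompleteSpace X] (hC : IsCosineFunction C) {M : ℝ}
    (hM : ∀ t, ‖C t‖ ≤ M) {p n : ℕ} (hpn : p ≤ n) (x : (opPow (generator C) p).domain) :
    ‖∫ t : ℝ, hermiteh (2 * n + 1) t • sine C t (x : X)‖ ≤
      M * √((2 * n - 2 * p).factorial : ℝ) / (2 ^ (n + p + 1) * ((2 * n + 1).factorial : ℝ)) *
        ‖opPow (generator C) p x‖ := by
  have hpi := Real.sqrt_pos.2 Real.pi_pos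
  have hf : (0 : ℝ) < (2 * n + 1).factorial := by exact_mod_cast Nat.factorial_pos _
  rw [integral_hermiteh_odd hC hM, norm_smul, Real.norm_eq_abs, abs_of_pos (by positivity)]
  refine (mul_le_mul_of_nonneg_left (norm_gaussCoeff_opPow_le hC hM hpn x)
    (by positivity)).trans_eq ?_
  rw [pow_succ, pow_mul']
  field_simp
  ring

lemma norm_integral_hermiteh_odd_le_succ [CompleteSpace X] (hC : IsCosineFunction C) {M : ℝ}
    (hM : ∀ t, ‖C t‖ ≤ M) {p n : ℕ} (hpn : p + 1 ≤ n)
    (x : (opPow (generator C) (p + 1)).domain) :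
    ‖∫ t : ℝ, hermiteh (2 * n + 1) t • sine C t (x : X)‖ ≤
      M * √((2 * n - 2 * p).factorial : ℝ) / (2 ^ (n + p + 1) * ((2 * n + 1).factorial : ℝ)) *
        ‖opPow (generator C) (p + 1) x‖ := by
  have hM0 : 0 ≤ M := (norm_nonneg _).trans (hM 0)
  refine (norm_integral_hermiteh_odd_le hC hM hpn x).trans ?_
  have h : ((2 * n - 2 * (p + 1)).factorial : ℝ) ≤ (2 * n - 2 * p).factorial := by
    exact_mod_cast Nat.factorial_le (by omega)
  gcongr
  · exact one_le_two
  · exact Nat.le_succ p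

lemma exists_locally_uniform_rate [CompleteSpace X] (hC : IsCosineFunction C) {M : ℝ}
    (hM1 : 1 ≤ M) (hM : ∀ t, ‖C t‖ ≤ M) (K : Set ℝ) (hK : IsCompact K) :
    ∃ m₀ : ℕ, 1 ≤ m₀ ∧ ∀ p : ℕ, 1 ≤ p → ∃ c : ℝ, 0 < c ∧
      ∀ m : ℕ, m₀ ≤ m → p ≤ m + 1 → ∀ t ∈ K,
        (∀ x : (opPow (generator C) p).domain,
          ‖C t (x : X) - cosPartial C m t x‖ ≤
            c / (m : ℝ) ^ ((p : ℝ) - 11 / 12) * ‖opPow (generator C) p x‖) ∧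
        (∀ x : (opPow (generator C) p).domain,
          ‖sine C t (x : X) - sinPartial C m t x‖ ≤
            c / (m : ℝ) ^ ((p : ℝ) - 5 / 12) * ‖opPow (generator C) p x‖) ∧
        (p ≤ m → ∀ x : (opPow (generator C) (p + 1)).domain,
          ‖sine C t (x : X) - sinPartial C m t x‖ ≤
            c / (m : ℝ) ^ ((p : ℝ) - 5 / 12) * ‖opPow (generator C) (p + 1) x‖) := by
  -- Time enters the estimates only through `e^{t^2}`, which is at most `e^{R^2}` on `K`; already
  -- `m₀ = 1` works.
  obtain ⟨R, hR⟩ := hK.isBounded.exists_norm_le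
  refine ⟨1, le_rfl, fun p hp => ⟨12 * Real.exp (R ^ 2) * p ^ p * M, ?_, fun m hm hpm t ht => ?_⟩⟩
  · have : (0 : ℝ) < p := by exact_mod_cast hp
    positivity
  have hM0 : 0 ≤ M := by linarith
  have ht2 : Real.exp (t ^ 2) ≤ Real.exp (R ^ 2) := by
    refine Real.exp_le_exp.2 ?_
    rw [← sq_abs]
    exact pow_le_pow_left₀ (abs_nonneg t) (hR t ht) 2
  have hconst : ∀ b q : ℝ, 0 ≤ b → 12 * Real.exp (t ^ 2) * p ^ p * (M * b) / (m : ℝ) ^ q ≤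
      12 * Real.exp (R ^ 2) * p ^ p * M / (m : ℝ) ^ q * b := by
    intro b q hb
    rw [div_mul_eq_mul_div, ← mul_assoc]
    have := Real.rpow_nonneg (Nat.cast_nonneg (α := ℝ) m) q
    gcongr
  refine ⟨fun x => ?_, fun x => ?_, fun hpm' x => ?_⟩
  · exact (norm_sub_cosPartial_le hC hM hp hm hpm (by positivity)
      (fun n hn => norm_powApply_le hC hM (by omega) x) t).trans (hconst _ _ (norm_nonneg _))
  · exact (norm_sub_sinPartial_le hC hM hp hm hpm (by positivity)
      (fun n hn => norm_powApply_le hC hM (by omega) x) t).trans (hconst _ _ (norm_nonneg _))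
  · exact (norm_sub_sinPartial_le hC hM hp hm hpm (by positivity)
      (fun n hn => norm_powApply_le_succ hC hM (by omega) x) t).trans (hconst _ _ (norm_nonneg _))

end

end CosineHermite

end

theorem theorem4p3 {X : Type*} [NormedAddCommGroup X] [NormedSpace ℂ X] [CompleteSpace X]
    (C : ℝ → X →L[ℂ] X) (hC : CosineHermite.IsCosineFunction C)
    (hbdd : ∃ M : ℝ, ∀ t : ℝ, ‖C t‖ ≤ M) :
    -- the objects of the statement are well defined
    (∀ (n : ℕ) (x : X),
      Integrable (fun t : ℝ => CosineHermite.hermiteh (2 * n) t • C t x) ∧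
      Integrable (fun t : ℝ => CosineHermite.hermiteh (2 * n + 1) t • CosineHermite.sine C t x) ∧
      CosineHermite.semigroup C (1 / 4) x ∈
        (CosineHermite.opPow (CosineHermite.generator C) n).domain) ∧
    -- even Hermite coefficients of the cosine function
    (∃ c : ℝ, 0 < c ∧ ∀ p : ℕ, 1 ≤ p → ∀ n : ℕ, p ≤ n →
      ∀ x : (CosineHermite.opPow (CosineHermite.generator C) p).domain,
        ‖∫ t : ℝ, CosineHermite.hermiteh (2 * n) t • C t (x : X)‖ ≤
          c * √((2 * n - 2 * p).factorial : ℝ) / (2 ^ (n + p) * ((2 * n).factorial : ℝ)) *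
            ‖CosineHermite.opPow (CosineHermite.generator C) p x‖) ∧
    -- odd Hermite coefficients of the sine function
    (∃ c : ℝ, 0 < c ∧ ∀ p n : ℕ, p ≤ n →
      (∀ x : (CosineHermite.opPow (CosineHermite.generator C) p).domain,
        ‖∫ t : ℝ, CosineHermite.hermiteh (2 * n + 1) t • CosineHermite.sine C t (x : X)‖ ≤
          c * √((2 * n - 2 * p).factorial : ℝ) / (2 ^ (n + p + 1) * ((2 * n + 1).factorial : ℝ)) *
            ‖CosineHermite.opPow (CosineHermite.generator C) p x‖) ∧
      (p + 1 ≤ n → ∀ x : (CosineHermite.opPow (CosineHermite.generator C) (p + 1)).domain,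
        ‖∫ t : ℝ, CosineHermite.hermiteh (2 * n + 1) t • CosineHermite.sine C t (x : X)‖ ≤
          c * √((2 * n - 2 * p).factorial : ℝ) / (2 ^ (n + p + 1) * ((2 * n + 1).factorial : ℝ)) *
            ‖CosineHermite.opPow (CosineHermite.generator C) (p + 1) x‖)) ∧
    -- rate of convergence at a fixed time
    (∀ t : ℝ, ∃ m₀ : ℕ, 1 ≤ m₀ ∧ ∀ p : ℕ, 1 ≤ p → ∃ c : ℝ, 0 < c ∧
      ∀ m : ℕ, m₀ ≤ m → p ≤ m + 1 →
        (∀ x : (CosineHermite.opPow (CosineHermite.generator C) p).domain,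
          ‖C t (x : X) - CosineHermite.cosPartial C m t x‖ ≤
            c / (m : ℝ) ^ ((p : ℝ) - 11 / 12) *
              ‖CosineHermite.opPow (CosineHermite.generator C) p x‖) ∧
        (∀ x : (CosineHermite.opPow (CosineHermite.generator C) p).domain,
          ‖CosineHermite.sine C t (x : X) - CosineHermite.sinPartial C m t x‖ ≤
            c / (m : ℝ) ^ ((p : ℝ) - 5 / 12) *
              ‖CosineHermite.opPow (CosineHermite.generator C) p x‖) ∧
        (p ≤ m → ∀ x : (CosineHermite.opPow (CosineHermite.generator C) (p + 1)).domain,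
          ‖CosineHermite.sine C t (x : X) - CosineHermite.sinPartial C m t x‖ ≤
            c / (m : ℝ) ^ ((p : ℝ) - 5 / 12) *
              ‖CosineHermite.opPow (CosineHermite.generator C) (p + 1) x‖)) ∧
    -- rate of convergence, locally uniformly in time
    (∀ K : Set ℝ, IsCompact K → ∃ m₀ : ℕ, 1 ≤ m₀ ∧ ∀ p : ℕ, 1 ≤ p → ∃ c : ℝ, 0 < c ∧
      ∀ m : ℕ, m₀ ≤ m → p ≤ m + 1 → ∀ t ∈ K,
        (∀ x : (CosineHermite.opPow (CosineHermite.generator C) p).domain,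
          ‖C t (x : X) - CosineHermite.cosPartial C m t x‖ ≤
            c / (m : ℝ) ^ ((p : ℝ) - 11 / 12) *
              ‖CosineHermite.opPow (CosineHermite.generator C) p x‖) ∧
        (∀ x : (CosineHermite.opPow (CosineHermite.generator C) p).domain,
          ‖CosineHermite.sine C t (x : X) - CosineHermite.sinPartial C m t x‖ ≤
            c / (m : ℝ) ^ ((p : ℝ) - 5 / 12) *
              ‖CosineHermite.opPow (CosineHermite.generator C) p x‖) ∧
        (p ≤ m → ∀ x : (CosineHermite.opPow (CosineHermite.generator C) (p + 1)).domain,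
          ‖CosineHermite.sine C t (x : X) - CosineHermite.sinPartial C m t x‖ ≤
            c / (m : ℝ) ^ ((p : ℝ) - 5 / 12) *
              ‖CosineHermite.opPow (CosineHermite.generator C) (p + 1) x‖)) ∧
    -- the Fejér family; the summand with index n here is the one with index n + 1 of the sum from 1
    (∀ (x : X) (t : ℝ),
      IntegrableOn (fun s : ℝ => CosineHermite.fejerKernel t s • C s x) (Set.Ioi 0) ∧
      IntegrableOn (fun s : ℝ =>
        ((1 - Real.exp (-s ^ 2 / 4)) / (Real.pi * s ^ 2)) • C s x) (Set.Ioi 0) ∧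
      (∀ n : ℕ, IntegrableOn (fun s : ℝ =>
        ((-1) ^ n * s ^ (2 * n) * Real.exp (-s ^ 2 / 4) /
          (2 ^ (2 * (n + 1)) * ((2 * (n + 1)).factorial : ℝ) * Real.pi)) • C s x) (Set.Ioi 0)) ∧
      HasSum
        (fun n : ℕ => (2 * CosineHermite.hermiteH (2 * (n + 1)) t) •
          ∫ s in Set.Ioi (0 : ℝ), ((-1) ^ n * s ^ (2 * n) * Real.exp (-s ^ 2 / 4) /
            (2 ^ (2 * (n + 1)) * ((2 * (n + 1)).factorial : ℝ) * Real.pi)) • C s x)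
        (CosineHermite.fejerFamily C t x -
          (2 : ℝ) • ∫ s in Set.Ioi (0 : ℝ),
            ((1 - Real.exp (-s ^ 2 / 4)) / (Real.pi * s ^ 2)) • C s x)) := by
  obtain ⟨M, hM1, hM⟩ := CosineHermite.exists_one_le_bound hbdd
  have hlocal := CosineHermite.exists_locally_uniform_rate hC hM1 hM
  refine ⟨fun n x => ⟨?_, ?_, ?_⟩, ⟨M, by linarith, fun p _ n hpn x => ?_⟩,
    ⟨M, by linarith, fun p n hpn => ⟨fun x => ?_, fun hpn1 x => ?_⟩⟩, fun t => ?_, hlocal,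
    fun x t => ⟨?_, ?_, fun n => ?_, ?_⟩⟩
  · exact CosineHermite.integrable_smul_of_bounded (CosineHermite.integrable_hermiteh _)
      (hC.strong_cont x) fun s => CosineHermite.IsCosineFunction.norm_apply_le hM s x
  · exact CosineHermite.integrable_hermiteh_smul_sine hC hM _ x
  · exact (CosineHermite.opPow_semigroup hC hM n x).1
  · exact CosineHermite.norm_integral_hermiteh_even_le hC hM hpn x
  · exact CosineHermite.norm_integral_hermiteh_odd_le hC hM hpn x
  · exact CosineHermite.norm_integral_hermiteh_odd_le_succ hC hM hpn1 x
  -- A fixed time is the compact set `{t}`.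
  · obtain ⟨m₀, hm₀, h⟩ := hlocal {t} isCompact_singleton
    refine ⟨m₀, hm₀, fun p hp => ?_⟩
    obtain ⟨c, hc, h⟩ := h p hp
    exact ⟨c, hc, fun m hm hpm => h m hm hpm t rfl⟩
  · exact CosineHermite.integrableOn_fejerKernel_smul hC hM t x
  · exact CosineHermite.integrableOn_heat_smul hC hM x
  · exact CosineHermite.integrableOn_fejerCoeff_smul hC hM n x
  · exact CosineHermite.hasSum_fejerFamily hC hM x t
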